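/- Let $G$ be a finite connected simple graph on at least three vertices. For a vertex $v$ and an integer $r\ge 1$, let $M_r(v)$ be the set of vertices at distance at most $r$ from $v$ in $G$, and let $G_r(v)$, the ball of radius $r$ centered at $v$, be the subgraph of $G$ induced by $M_r(v)$. A vertex $x$ of $G_r(v)$ is called an interior vertex of $G_r(v)$ if $G_1(x)$ is a subgraph of $G_r(v)$. Let $d(x)$ denote the degree of $x$ in $G$, and let the connectivity $\kappa(H)$ of a finite graph $H$ be the smallest number of vertices whose removal turns $H$ into a disconnected graph or a graph with at most one vertex. A graph is 2-connected if it has at least three vertices and remains connected whenever fewer than two vertices are removed. Suppose that every ball of radius $3$ in $G$ is 2-connected, and that $$d(x)+d(y)+d(z)\ \ge\ |M_3(v)|+\kappa\bigl(G_3(v)\bigr)$$ for every vertex $v$ of $G$ and every three distinct, pairwise non-adjacent interior vertices $x,y,z$ of $G_3(v)$. Then $G$ is Hamiltonian, that is, $G$ has a cycle containing every vertex of $G$. -/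

import Mathlib

namespace SimpleGraph

/-- `M_r(v)`: the set of vertices at distance at most `r` from `v`. The extended distance is used,
so that vertices in other components (at distance `⊤`) are never included. -/
def closedBall {V : Type*} (G : SimpleGraph V) (r : ℕ) (v : V) : Set V :=
  {w | G.edist v w ≤ (r : ℕ∞)}

/-- `G_r(v)`: the ball of radius `r` centred at `v`, that is, the subgraph of `G` induced
by `M_r(v)`. -/
abbrev ballGraph {V : Type*} (G : SimpleGraph V) (r : ℕ) (v : V) :
    SimpleGraph (G.closedBall r v) :=
  G.induce (G.closedBall r v)

/-- A vertex `x` of `G_r(v)` is an interior vertex of `G_r(v)` if the ball `G_1(x)` is a subgraph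
of `G_r(v)`. Both are induced subgraphs of `G`, so this means that the vertex set of the first is
contained in the vertex set of the second. -/
def IsInteriorVertex {V : Type*} (G : SimpleGraph V) (r : ℕ) (v x : V) : Prop :=
  x ∈ G.closedBall r v ∧ G.closedBall 1 x ⊆ G.closedBall r v

/-- A graph is `k`-connected if it has more than `k` vertices and it remains connected
whenever fewer than `k` vertices are removed. -/
def IsKConnected {W : Type*} [Finite W] (H : SimpleGraph W) (k : ℕ) : Prop :=
  k < Nat.card W ∧ ∀ S : Finset W, S.card < k → (H.induce ((S : Set W)ᶜ)).Connected

/-- The connectivity `κ(H)` of a finite graph: the smallest number of vertices whose removal turns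
`H` into a disconnected or trivial graph (trivial: at most one vertex). Removing all the vertices
is always possible, so the infimum is over a nonempty set and is attained. -/
noncomputable def connectivity {W : Type*} [Finite W] (H : SimpleGraph W) : ℕ :=
  sInf {k | ∃ S : Finset W, S.card = k ∧
    (¬ (H.induce ((S : Set W)ᶜ)).Preconnected ∨ ((S : Set W)ᶜ).Subsingleton)}

end SimpleGraph

/-!
Suppose that `G` is not Hamiltonian. Take a longest cycle (a single edge counts as a cycle of
length two) and a component `H` of its complement, recorded in the structure `IsStuck`
(`Connected.exists_isStuck`). A vertex outside `H` with a neighbour in `H` is called attached;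
attached vertices lie on the cycle. Everything rests on the crossing lemma `IsPathMap.crossing`
and its form `IsStuck.crossing` on the cycle: for the successors `x` and `x'` of two attached
vertices, the neighbours of `x`, shifted along the cycle, are not neighbours of `x'`, since
otherwise the cycle could be rerouted through `H`. Hence `x` and `x'` are not adjacent and their
degree sum is small. As no successor has a neighbour in `H`, a vertex of `H` completes them to an
independent triple, and the degree condition makes `H` have many neighbours on the cycle. There are
two cases.

If some ball of radius three is the whole graph, then the degree sum of every independent triple is
at least `n + κ`, where `n` is the order and `κ` the connectivity of `G`. The crossing lemma yields
more than `κ` attached vertices, so the successor of one of them lies outside a minimum separator,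
and counting neighbours on the two sides of the separator gives a contradiction
(`IsStuck.false_of_isSeparation`).

Otherwise every vertex has a vertex at distance four, and only `κ ≥ 2` for the balls is needed
(`TripleCondition`). The main tool is `TripleCondition.card_add_two_le`, by which the vertices of a
ball outside the neighbourhoods of a triple are outnumbered by the pairwise overlaps of these
neighbourhoods. Some `v ∈ H` has at least two neighbours on the cycle: if not, the punctured ball
around an attached vertex `w` has an edge that leads from an attached vertex `w'` to a vertex near
the successor of `w`, and rerouting the cycle twice enlarges it (`IsStuck.false_of_two_reroutes`,
`IsStuck.exists_two_le_card_outNbrs`). For such a `v`, the neighbours on the cycle of `v` and of its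
neighbours in `H` form disjoint sets (`IsStuck.not_adj_of_mem_outNbrs`,
`IsStuck.three_le_card_outNbrs_of_adj`). The successors of the neighbours of `v` are close to each
other and to every vertex at distance four from `v` (`IsStuck.dist_nxt_le_two_of_dist_eq_four`),
and a vertex `y` at distance four from one of them has distance six from `v`
(`IsStuck.dist_eq_six`). Two of these successors together with `y` then contradict the degree
condition in the ball around a vertex at distance four from `v` and two from `y`
(`IsStuck.false_of_forall_exists_dist_eq_four`).
-/

namespace SimpleGraph

open Finset

/-! ### Vertex sets of paths and the crossing lemma -/

/-- There is a path of `G` from `a` to `b` whose vertex set is exactly `s`. The path is encoded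
by its enumeration `p 0, …, p n`; values of `p` beyond `n` are irrelevant. -/
def PathOn {V : Type*} [DecidableEq V] (G : SimpleGraph V) (s : Finset V) (a b : V) : Prop :=
  ∃ (n : ℕ) (p : ℕ → V), p 0 = a ∧ p n = b ∧ Set.InjOn p (Set.Iic n) ∧
    (∀ i < n, G.Adj (p i) (p (i + 1))) ∧ (range (n + 1)).image p = s

/-- An injective enumeration of a path, indexed by `0, …, n`. -/
structure IsPathMap {V : Type*} (G : SimpleGraph V) (n : ℕ) (p : ℕ → V) : Prop where
  inj : Set.InjOn p (Set.Iic n)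
  adj : ∀ i < n, G.Adj (p i) (p (i + 1))

lemma IsPathMap.ne {V : Type*} {G : SimpleGraph V} {n : ℕ} {p : ℕ → V} (hp : G.IsPathMap n p)
    {i j : ℕ} (hi : i ≤ n) (hj : j ≤ n) (hij : i ≠ j) : p i ≠ p j :=
  fun h => hij (hp.inj hi hj h)

section Paths

variable {V : Type*} [DecidableEq V] {G : SimpleGraph V}

lemma PathOn.left_mem {s : Finset V} {a b : V} (h : G.PathOn s a b) : a ∈ s := by
  obtain ⟨n, p, rfl, -, -, -, rfl⟩ := h
  exact mem_image_of_mem _ (by simp)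

lemma PathOn.right_mem {s : Finset V} {a b : V} (h : G.PathOn s a b) : b ∈ s := by
  obtain ⟨n, p, -, rfl, -, -, rfl⟩ := h
  exact mem_image_of_mem _ (by simp)

lemma PathOn.symm {s : Finset V} {a b : V} (h : G.PathOn s a b) : G.PathOn s b a := by
  obtain ⟨n, p, rfl, rfl, hinj, hadj, rfl⟩ := h
  refine ⟨n, fun i => p (n - i), by simp, by simp, ?_, ?_, ?_⟩
  · intro i hi j hj hij
    simp only [Set.mem_Iic] at hi hj
    have := hinj (by simp) (by simp) hij
    omega
  · intro i hi
    have := hadj (n - (i + 1)) (by omega)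
    rw [show n - (i + 1) + 1 = n - i by omega] at this
    exact this.symm
  · ext x
    simp only [mem_image, mem_range]
    constructor
    · rintro ⟨i, hi, rfl⟩; exact ⟨n - i, by omega, rfl⟩
    · rintro ⟨i, hi, rfl⟩; exact ⟨n - i, by omega, by rw [show n - (n - i) = i by omega]⟩

lemma PathOn.append {s t : Finset V} {a b c d : V} (h : G.PathOn s a b) (h' : G.PathOn t c d)
    (hst : Disjoint s t) (hbc : G.Adj b c) : G.PathOn (s ∪ t) a d := by
  obtain ⟨n, p, rfl, rfl, hinj, hadj, rfl⟩ := h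
  obtain ⟨m, q, rfl, rfl, hinj', hadj', rfl⟩ := h'
  have hne : ∀ i ≤ n, ∀ j ≤ m, p i ≠ q j := fun i hi j hj he =>
    Finset.disjoint_left.mp hst (mem_image_of_mem p (by simp; omega))
      (he ▸ mem_image_of_mem q (by simp; omega))
  refine ⟨n + m + 1, fun i => if i ≤ n then p i else q (i - n - 1), by simp, ?_, ?_, ?_, ?_⟩
  · simp only [show ¬ n + m + 1 ≤ n by omega, if_false]
    congr 1; omega
  · intro i hi j hj hij
    simp only [Set.mem_Iic] at hi hj
    by_cases h1 : i ≤ n <;> by_cases h2 : j ≤ n <;> simp only [h1, h2, if_true, if_false] at hij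
    · exact hinj h1 h2 hij
    · exact absurd hij (hne _ h1 _ (by omega))
    · exact absurd hij.symm (hne _ h2 _ (by omega))
    · have := hinj' (show i - n - 1 ∈ Set.Iic m by simp; omega)
        (show j - n - 1 ∈ Set.Iic m by simp; omega) hij
      omega
  · intro i hi
    rcases lt_trichotomy i n with h1 | h1 | h1
    · simp only [h1.le, show i + 1 ≤ n by omega, if_true]
      exact hadj i h1
    · subst h1
      simpa using hbc
    · simp only [show ¬ i ≤ n by omega, show ¬ i + 1 ≤ n by omega, if_false]
      have := hadj' (i - n - 1) (by omega)
      rwa [show i - n - 1 + 1 = i + 1 - n - 1 by omega] at this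
  · ext x
    simp only [mem_image, mem_range, mem_union]
    constructor
    · rintro ⟨i, hi, rfl⟩
      by_cases h1 : i ≤ n
      · exact Or.inl ⟨i, by omega, by simp [h1]⟩
      · exact Or.inr ⟨i - n - 1, by omega, by simp [h1]⟩
    · rintro (⟨i, hi, rfl⟩ | ⟨i, hi, rfl⟩)
      · exact ⟨i, by omega, by simp [show i ≤ n by omega]⟩
      · refine ⟨n + 1 + i, by omega, ?_⟩
        simp only [show ¬ n + 1 + i ≤ n by omega, if_false]
        congr 1; omega

lemma PathOn.singleton (a : V) : G.PathOn {a} a a :=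
  ⟨0, fun _ => a, rfl, rfl, by intro i hi j hj _; simp at hi hj; omega, by simp, by simp⟩

lemma PathOn.exists_isPathMap {s : Finset V} {a b : V} (h : G.PathOn s a b) :
    ∃ n p, G.IsPathMap n p ∧ p 0 = a ∧ p n = b ∧ (range (n + 1)).image p = s := by
  obtain ⟨n, p, h0, hn, hinj, hadj, hs⟩ := h
  exact ⟨n, p, ⟨hinj, hadj⟩, h0, hn, hs⟩

namespace IsPathMap

variable {n : ℕ} {p : ℕ → V}

lemma interval (hp : G.IsPathMap n p) {i j : ℕ} (hij : i ≤ j) (hj : j ≤ n) :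
    G.PathOn ((Icc i j).image p) (p i) (p j) := by
  refine ⟨j - i, fun k => p (i + k), by simp, by simp only; congr 1; omega, ?_, ?_, ?_⟩
  · intro a ha b hb hab
    simp only [Set.mem_Iic] at ha hb
    have := hp.inj (show i + a ∈ Set.Iic n by simp; omega) (show i + b ∈ Set.Iic n by simp; omega)
      hab
    omega
  · intro k hk
    exact hp.adj (i + k) (by omega)
  · ext x
    simp only [mem_image, mem_range, mem_Icc]
    constructor
    · rintro ⟨k, hk, rfl⟩; exact ⟨i + k, by omega, rfl⟩
    · rintro ⟨k, hk, rfl⟩; exact ⟨k - i, by omega, by congr 1; omega⟩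

lemma pathOn (hp : G.IsPathMap n p) : G.PathOn ((range (n + 1)).image p) (p 0) (p n) :=
  ⟨n, p, rfl, rfl, hp.inj, hp.adj, rfl⟩

lemma disjoint_image (hp : G.IsPathMap n p) {I J : Finset ℕ} (hI : ∀ i ∈ I, i ≤ n)
    (hJ : ∀ i ∈ J, i ≤ n) (hIJ : Disjoint I J) : Disjoint (I.image p) (J.image p) := by
  rw [Finset.disjoint_left]
  intro x hx hx'
  obtain ⟨i, hi, rfl⟩ := mem_image.mp hx
  obtain ⟨j, hj, hij⟩ := mem_image.mp hx'
  have := hp.inj (hJ j hj) (hI i hi) hij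
  subst this
  exact Finset.disjoint_left.mp hIJ hi hj

lemma append (hp : G.IsPathMap n p) {I J : Finset ℕ} {a b c d : V}
    (h : G.PathOn (I.image p) a b) (h' : G.PathOn (J.image p) c d) (hI : ∀ i ∈ I, i ≤ n)
    (hJ : ∀ i ∈ J, i ≤ n) (hIJ : Disjoint I J) (hbc : G.Adj b c) :
    G.PathOn ((I ∪ J).image p) a d := by
  rw [image_union]
  exact h.append h' (hp.disjoint_image hI hJ hIJ) hbc

end IsPathMap

/-- The crossing lemma. On a path `p 0, …, p n` let `a = p (m - 1)` and `e = p n`. If the path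
cannot be rerouted, within the complement of `H`, to a path from `p 0` to `p m` through all its
vertices, then `a` and `e` are not adjacent, and shifting the neighbours of `a` along the path
towards `p (m - 1)` or `p m` gives a set `T` avoiding the neighbours of `e`. Any further set `M`
avoiding these sets gives a saving in the bound for the degree sum of `a` and `e`.

Writing `b` for `p m`, the reroutings are `p 0 ⋯ p t, a ⋯ p (t + 1), e ⋯ b` for `t + 1 < m`,
`p 0 ⋯ a, p t ⋯ e, p (t - 1) ⋯ b` for `m < t`, and `p 0 ⋯ a, o, e ⋯ b` for a common neighbour `o`
of `a` and `e` off the path. -/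
theorem IsPathMap.crossing [Fintype V] [DecidableRel G.Adj] {n m : ℕ} {p : ℕ → V}
    (hp : G.IsPathMap n p) {H : Finset V} (hm : 1 ≤ m) (hmn : m ≤ n)
    (hpH : ∀ i ≤ n, p i ∉ H) (ha : ∀ h ∈ H, ¬ G.Adj (p (m - 1)) h)
    (hno : ∀ s, (range (n + 1)).image p ⊆ s → Disjoint s H → ¬ G.PathOn s (p 0) (p m)) :
    ¬ G.Adj (p (m - 1)) (p n) ∧ ∃ T : Finset V,
      (∀ y ∈ T, (∃ t, t + 1 < m ∧ G.Adj (p (m - 1)) (p t) ∧ y = p (t + 1)) ∨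
        ∃ t, m < t ∧ t ≤ n ∧ G.Adj (p (m - 1)) (p t) ∧ y = p (t - 1)) ∧
      ∀ D M : Finset V, G.neighborFinset (p (m - 1)) ⊆ D → G.neighborFinset (p n) ⊆ D →
        T ⊆ D → p n ∈ D → M ⊆ D →
        (∀ u ∈ M, u ∉ T ∧ ¬ G.Adj (p n) u ∧ u ≠ p n ∧
          (G.Adj (p (m - 1)) u → ∃ t ≤ n, u = p t)) →
        G.degree (p (m - 1)) + G.degree (p n) + M.card ≤ D.card := by
  have hHd : Disjoint ((range (n + 1)).image p) H := by
    rw [Finset.disjoint_left]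
    intro x hx
    obtain ⟨i, hi, rfl⟩ := mem_image.mp hx
    exact hpH i (by simpa [Nat.lt_succ_iff] using hi)
  have hno' : ∀ I : Finset ℕ, I = range (n + 1) → ¬ G.PathOn (I.image p) (p 0) (p m) := by
    rintro I rfl
    exact hno _ (Subset.refl _) hHd
  have hmn' : m < n := by
    rcases hmn.lt_or_eq with h | h
    · exact h
    · subst h
      exact absurd hp.pathOn (hno' _ rfl)
  have hfst : G.PathOn ((Icc 0 (m - 1)).image p) (p 0) (p (m - 1)) :=
    hp.interval (by omega) (by omega)
  have hlst : G.PathOn ((Icc m n).image p) (p n) (p m) := (hp.interval hmn le_rfl).symm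
  have hae : ¬ G.Adj (p (m - 1)) (p n) := by
    intro h
    refine hno' _ ?_ (hp.append hfst hlst (by simp; omega) (by simp)
      (by rw [Finset.disjoint_left]; simp; omega) h)
    ext i; simp; omega
  have hcr1 : ∀ t, t + 1 < m → G.Adj (p (m - 1)) (p t) → ¬ G.Adj (p n) (p (t + 1)) := by
    intro t ht h1 h2
    have e1 : G.PathOn ((Icc 0 t).image p) (p 0) (p t) := hp.interval (by omega) (by omega)
    have e2 : G.PathOn ((Icc (t + 1) (m - 1)).image p) (p (m - 1)) (p (t + 1)) :=
      (hp.interval (by omega) (by omega)).symm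
    have e3 := hp.append e1 e2 (by simp; omega) (by simp; omega)
      (by rw [Finset.disjoint_left]; simp; omega) h1.symm
    refine hno' _ ?_ (hp.append e3 hlst (by simp; omega) (by simp)
      (by rw [Finset.disjoint_left]; simp; omega) h2.symm)
    ext i; simp; omega
  have hcr2 : ∀ t, m < t → t ≤ n → G.Adj (p (m - 1)) (p t) → ¬ G.Adj (p n) (p (t - 1)) := by
    intro t ht htn h1 h2
    have e2 : G.PathOn ((Icc t n).image p) (p t) (p n) := hp.interval (by omega) (by omega)
    have e3 : G.PathOn ((Icc m (t - 1)).image p) (p (t - 1)) (p m) :=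
      (hp.interval (by omega) (by omega)).symm
    have e4 := hp.append hfst e2 (by simp; omega) (by simp)
      (by rw [Finset.disjoint_left]; simp; omega) h1
    refine hno' _ ?_ (hp.append e4 e3 (by simp; omega) (by simp; omega)
      (by rw [Finset.disjoint_left]; simp; omega) h2)
    ext i; simp; omega
  have hout : ∀ o, (∀ i ≤ n, o ≠ p i) → G.Adj (p (m - 1)) o → ¬ G.Adj (p n) o := by
    intro o ho h1 h2
    have hoH : o ∉ H := fun h => ha o h h1
    have d1 : ∀ I : Finset ℕ, (∀ i ∈ I, i ≤ n) → Disjoint (I.image p) {o} := by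
      intro I hI
      rw [Finset.disjoint_singleton_right]
      intro hx
      obtain ⟨i, hi, h⟩ := mem_image.mp hx
      exact ho i (hI i hi) h.symm
    have e1 := hfst.append (PathOn.singleton o) (d1 _ (by simp; omega)) h1
    have e2 := e1.append hlst (by
      rw [Finset.disjoint_union_left]
      exact ⟨hp.disjoint_image (by simp; omega) (by simp)
        (by rw [Finset.disjoint_left]; simp; omega), (d1 _ (by simp)).symm⟩) h2.symm
    refine hno _ ?_ ?_ e2
    · intro x hx
      obtain ⟨i, hi, rfl⟩ := mem_image.mp hx
      simp only [mem_range] at hi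
      by_cases him : i ≤ m - 1
      · exact mem_union_left _ (mem_union_left _ (mem_image_of_mem _ (by simp; omega)))
      · exact mem_union_right _ (mem_image_of_mem _ (by simp; omega))
    · rw [Finset.disjoint_union_left, Finset.disjoint_union_left]
      refine ⟨⟨hHd.mono_left (image_subset_image ?_), by simpa using hoH⟩,
        hHd.mono_left (image_subset_image ?_)⟩
      · intro i; simp; omega
      · intro i; simp
  refine ⟨hae, ?_⟩
  -- the neighbours of `a` on the path other than `p m` and their shifts `σ`
  set I : Finset ℕ := (range (n + 1)).filter (fun t => G.Adj (p (m - 1)) (p t) ∧ t ≠ m) with hI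
  have hImem : ∀ t ∈ I, t ≤ n ∧ G.Adj (p (m - 1)) (p t) ∧ (t + 1 < m ∨ m < t) := by
    intro t ht
    simp only [hI, mem_filter, mem_range] at ht
    refine ⟨by omega, ht.2.1, ?_⟩
    have : t ≠ m - 1 := fun h => G.loopless.irrefl _ (h ▸ ht.2.1)
    omega
  set σ : ℕ → ℕ := fun t => if t < m then t + 1 else t - 1 with hσ
  have hσ1 : ∀ t, t < m → σ t = t + 1 := fun t h => by simp [hσ, h]
  have hσ2 : ∀ t, m < t → σ t = t - 1 := fun t h => by simp [hσ, show ¬ t < m by omega]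
  have hσlt : ∀ t ∈ I, σ t < n := by
    intro t ht
    obtain ⟨h1, -, h2 | h2⟩ := hImem t ht
    · rw [hσ1 t (by omega)]; omega
    · rw [hσ2 t h2]; omega
  have hTcard : (I.image (p ∘ σ)).card = I.card := by
    refine card_image_of_injOn ?_
    intro t ht t' ht' h
    have h1 := hσlt t ht
    have h1' := hσlt t' ht'
    have h2 := hp.inj (show σ t ∈ Set.Iic n by simp; omega) (show σ t' ∈ Set.Iic n by simp; omega) h
    obtain ⟨-, -, h3⟩ := hImem t ht
    obtain ⟨-, -, h3'⟩ := hImem t' ht'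
    rcases h3 with h3 | h3 <;> rcases h3' with h3' | h3'
    · rw [hσ1 t (by omega), hσ1 t' (by omega)] at h2; omega
    · rw [hσ1 t (by omega), hσ2 t' h3'] at h2; omega
    · rw [hσ2 t h3, hσ1 t' (by omega)] at h2; omega
    · rw [hσ2 t h3, hσ2 t' h3'] at h2; omega
  have hTdesc : ∀ y ∈ I.image (p ∘ σ),
      (∃ t, t + 1 < m ∧ G.Adj (p (m - 1)) (p t) ∧ y = p (t + 1)) ∨
        ∃ t, m < t ∧ t ≤ n ∧ G.Adj (p (m - 1)) (p t) ∧ y = p (t - 1) := by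
    intro y hy
    obtain ⟨t, ht, rfl⟩ := mem_image.mp hy
    obtain ⟨h1, h2, h3 | h3⟩ := hImem t ht
    · exact Or.inl ⟨t, h3, h2, by simp [hσ1 t (by omega)]⟩
    · exact Or.inr ⟨t, h3, h1, h2, by simp [hσ2 t h3]⟩
  refine ⟨I.image (p ∘ σ), hTdesc, ?_⟩
  intro D M hD1 hD2 hD3 hD4 hD5 hM
  set R : Finset V := (range (n + 1)).image p with hR
  have hRmem : ∀ u, u ∈ R ↔ ∃ t ≤ n, u = p t := by
    intro u
    simp only [hR, mem_image, mem_range, Nat.lt_succ_iff]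
    constructor
    · rintro ⟨t, h, rfl⟩; exact ⟨t, h, rfl⟩
    · rintro ⟨t, h, rfl⟩; exact ⟨t, h, rfl⟩
  have hNa : (G.neighborFinset (p (m - 1))).card ≤
      I.card + 1 + (G.neighborFinset (p (m - 1)) \ R).card := by
    rw [← card_sdiff_add_card_inter (G.neighborFinset (p (m - 1))) R, add_comm]
    gcongr
    calc _ ≤ ((insert m I).image p).card := by
          refine card_le_card ?_
          intro u hu
          rw [mem_inter, mem_neighborFinset, hRmem] at hu
          obtain ⟨hu, t, ht, rfl⟩ := hu
          refine mem_image_of_mem _ ?_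
          rw [mem_insert]
          by_cases htm : t = m
          · exact Or.inl htm
          · right; simp [hI, htm, hu]; omega
      _ ≤ (insert m I).card := card_image_le
      _ ≤ I.card + 1 := card_insert_le _ _
  set T := I.image (p ∘ σ) with hT
  -- `T`, the neighbours `Q` of `a` off the path, the neighbours of `e`, `e` and `M` are disjoint
  set Q := G.neighborFinset (p (m - 1)) \ R with hQ
  have hTR : T ⊆ R := by
    intro y hy
    obtain ⟨t, ht, rfl⟩ := mem_image.mp hy
    exact (hRmem _).mpr ⟨σ t, (hσlt t ht).le, rfl⟩
  have h12 : Disjoint T Q := Finset.disjoint_left.mpr fun y hy hy' =>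
    (mem_sdiff.mp hy').2 (hTR hy)
  have hTE : ∀ y ∈ T, ¬ G.Adj (p n) y := by
    intro y hy
    rcases hTdesc y hy with ⟨t, h1, h2, rfl⟩ | ⟨t, h1, h2, h3, rfl⟩
    · exact hcr1 t h1 h2
    · exact hcr2 t h1 h2 h3
  have hTe : p n ∉ T := by
    intro hy
    obtain ⟨t, ht, h⟩ := mem_image.mp hy
    exact hp.ne (hσlt t ht).le le_rfl (hσlt t ht).ne h
  have hQE : ∀ y ∈ Q, ¬ G.Adj (p n) y := by
    intro y hy
    rw [hQ, mem_sdiff, mem_neighborFinset, hRmem] at hy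
    exact hout y (fun i hi h => hy.2 ⟨i, hi, h⟩) hy.1
  have hQe : p n ∉ Q := fun h => (mem_sdiff.mp h).2 ((hRmem _).mpr ⟨n, le_rfl, rfl⟩)
  have h3 : Disjoint (T ∪ Q) (G.neighborFinset (p n)) := Finset.disjoint_left.mpr fun y hy hy' => by
    rw [mem_neighborFinset] at hy'
    rcases mem_union.mp hy with h | h
    · exact hTE y h hy'
    · exact hQE y h hy'
  have h4 : Disjoint (T ∪ Q ∪ G.neighborFinset (p n)) (insert (p n) M) :=
    Finset.disjoint_left.mpr fun y hy hy' => by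
    rcases mem_insert.mp hy' with rfl | hy'
    · simp only [mem_union, mem_neighborFinset, SimpleGraph.irrefl, or_false] at hy
      exact hy.elim hTe hQe
    · obtain ⟨m1, m2, -, m4⟩ := hM y hy'
      simp only [mem_union, mem_neighborFinset] at hy
      rcases hy with (h | h) | h
      · exact m1 h
      · rw [hQ, mem_sdiff, mem_neighborFinset, hRmem] at h
        exact h.2 (m4 h.1)
      · exact m2 h
  have h5 : (T ∪ Q ∪ G.neighborFinset (p n) ∪ insert (p n) M).card ≤ D.card := by
    refine card_le_card ?_
    refine union_subset (union_subset (union_subset hD3 (sdiff_subset.trans hD1)) hD2) ?_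
    exact insert_subset hD4 hD5
  rw [card_union_of_disjoint h4, card_union_of_disjoint h3, card_union_of_disjoint h12,
    card_insert_of_notMem (fun h => (hM _ h).2.2.1 rfl), hTcard] at h5
  simp only [card_neighborFinset_eq_degree] at hNa h5
  omega

end Paths

/-! ### Distances and the degree condition on triples -/

section Distance

variable {V : Type*} {G : SimpleGraph V}

lemma Connected.exists_dist_le_of_dist_le_add (hG : G.Connected) {u v : V} {i j : ℕ}
    (h : G.dist u v ≤ i + j) : ∃ w, G.dist u w ≤ i ∧ G.dist w v ≤ j := by
  obtain ⟨p, hp⟩ := hG.exists_walk_length_eq_dist u v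
  refine ⟨p.getVert i, (dist_le (p.take i)).trans ?_, (dist_le (p.drop i)).trans ?_⟩
  · simp [Walk.take_length]
  · rw [Walk.drop_length]; omega

lemma Connected.exists_dist_eq_of_dist_eq_add (hG : G.Connected) {u v : V} {i j : ℕ}
    (h : G.dist u v = i + j) : ∃ w, G.dist u w = i ∧ G.dist w v = j := by
  obtain ⟨w, h1, h2⟩ := hG.exists_dist_le_of_dist_le_add h.le
  have := hG.dist_triangle (u := u) (v := w) (w := v)
  exact ⟨w, by omega, by omega⟩

lemma Adj.dist_le_one {u v : V} (h : G.Adj u v) : G.dist u v ≤ 1 := by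
  rw [dist_eq_one_iff_adj.mpr h]

lemma Connected.dist_le_add (hG : G.Connected) {u v w : V} {i j : ℕ} (h : G.dist u v ≤ i)
    (h' : G.dist v w ≤ j) : G.dist u w ≤ i + j :=
  (hG.dist_triangle (v := v)).trans (add_le_add h h')

lemma not_adj_of_two_le_dist {u v : V} (h : 2 ≤ G.dist u v) : ¬ G.Adj u v := fun h' => by
  have := h'.dist_le_one
  omega

lemma ne_of_one_le_dist {u v : V} (h : 1 ≤ G.dist u v) : u ≠ v := by
  rintro rfl
  simp at h

lemma Connected.two_le_dist (hG : G.Connected) {u v : V} (hne : u ≠ v) (h : ¬ G.Adj u v) :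
    2 ≤ G.dist u v := by
  have h0 : G.dist u v ≠ 0 := fun h0 => hne ((hG.dist_eq_zero_iff).mp h0)
  have h1 : G.dist u v ≠ 1 := fun h1 => h (dist_eq_one_iff_adj.mp h1)
  omega

lemma Connected.exists_common_neighbor (hG : G.Connected) {u v : V} (h : G.dist u v = 2) :
    ∃ w, G.Adj u w ∧ G.Adj w v := by
  obtain ⟨w, h1, h2⟩ := hG.exists_dist_eq_of_dist_eq_add (i := 1) (j := 1) h
  exact ⟨w, dist_eq_one_iff_adj.mp h1, dist_eq_one_iff_adj.mp h2⟩

end Distance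

section Triples

variable {V : Type*} [Fintype V] [DecidableEq V] (G : SimpleGraph V) [DecidableRel G.Adj]

/-- The set of vertices at distance at most `3` from `c`, as a finset, for use in connected
graphs. -/
noncomputable def ballThree (c : V) : Finset V := univ.filter fun u => G.dist c u ≤ 3

/-- The degree sum condition on independent triples within distance two of a common centre, with
the connectivity of the ball replaced by the lower bound `2`. -/
def TripleCondition : Prop :=
  ∀ c a b d : V, G.dist c a ≤ 2 → G.dist c b ≤ 2 → G.dist c d ≤ 2 → a ≠ b → a ≠ d → b ≠ d →
    ¬ G.Adj a b → ¬ G.Adj a d → ¬ G.Adj b d →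
    (G.ballThree c).card + 2 ≤ G.degree a + G.degree b + G.degree d

variable {G}

omit [DecidableEq V] [DecidableRel G.Adj] in
lemma mem_ballThree {c u : V} : u ∈ G.ballThree c ↔ G.dist c u ≤ 3 := by simp [ballThree]

omit [DecidableEq V] in
lemma Connected.neighborFinset_subset_ballThree (hG : G.Connected) {c a : V}
    (h : G.dist c a ≤ 2) : G.neighborFinset a ⊆ G.ballThree c := by
  intro u hu
  rw [mem_neighborFinset] at hu
  rw [mem_ballThree]
  exact hG.dist_le_add h hu.dist_le_one

/-- The degree condition bounds the vertices of a ball outside three neighbourhoods by the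
pairwise overlaps of these neighbourhoods. -/
theorem TripleCondition.card_add_two_le (hT : G.TripleCondition) (hG : G.Connected)
    {c a b d : V} (ha : G.dist c a ≤ 2) (hb : G.dist c b ≤ 2) (hd : G.dist c d ≤ 2)
    (hab : a ≠ b) (had : a ≠ d) (hbd : b ≠ d) (hab' : ¬ G.Adj a b) (had' : ¬ G.Adj a d)
    (hbd' : ¬ G.Adj b d) {R : Finset V}
    (hR : ∀ u ∈ R, G.dist c u ≤ 3 ∧ ¬ G.Adj a u ∧ ¬ G.Adj b u ∧ ¬ G.Adj d u) :
    R.card + 2 ≤ (G.neighborFinset a ∩ G.neighborFinset b).card +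
      (G.neighborFinset a ∩ G.neighborFinset d).card +
      (G.neighborFinset b ∩ G.neighborFinset d).card := by
  have h := hT c a b d ha hb hd hab had hbd hab' had' hbd'
  simp only [← card_neighborFinset_eq_degree] at h
  set A := G.neighborFinset a with hA
  set B := G.neighborFinset b with hB
  set E := G.neighborFinset d with hE
  have h1 := card_union_add_card_inter A B
  have h2 := card_union_add_card_inter (A ∪ B) E
  have h3 : ((A ∪ B) ∩ E).card ≤ (A ∩ E).card + (B ∩ E).card := by
    rw [union_inter_distrib_right]
    exact card_union_le _ _
  have h4 : Disjoint (A ∪ B ∪ E) R := by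
    rw [Finset.disjoint_left]
    intro u hu hu'
    obtain ⟨-, h5, h6, h7⟩ := hR u hu'
    simp only [hA, hB, hE, mem_union, mem_neighborFinset] at hu
    tauto
  have h5 : (A ∪ B ∪ E ∪ R).card ≤ (G.ballThree c).card := by
    refine card_le_card (union_subset (union_subset (union_subset ?_ ?_) ?_) ?_)
    · exact hG.neighborFinset_subset_ballThree ha
    · exact hG.neighborFinset_subset_ballThree hb
    · exact hG.neighborFinset_subset_ballThree hd
    · intro u hu
      exact mem_ballThree.mpr (hR u hu).1
  rw [card_union_of_disjoint h4] at h5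
  omega

/-- The neighbours of `v` outside `H`. -/
def outNbrs (G : SimpleGraph V) [DecidableRel G.Adj] (H : Finset V) (v : V) : Finset V :=
  G.neighborFinset v \ H

lemma mem_outNbrs {H : Finset V} {v w : V} : w ∈ G.outNbrs H v ↔ G.Adj v w ∧ w ∉ H := by
  simp [outNbrs]

/-- The crossing lemma combined with the degree condition for the triple `v`, `p (m - 1)`, `p n`,
where `v` lies in the forbidden set `H`: a vertex `v` with few neighbours outside `H` forces the
path to be reroutable. -/
theorem IsPathMap.card_add_three_le (hT : G.TripleCondition) (hG : G.Connected)
    {n m : ℕ} {p : ℕ → V} (hp : G.IsPathMap n p) {H : Finset V} (hm : 1 ≤ m) (hmn : m ≤ n)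
    (hpH : ∀ i ≤ n, p i ∉ H) (ha : ∀ h ∈ H, ¬ G.Adj h (p (m - 1)))
    (he : ∀ h ∈ H, ¬ G.Adj h (p n))
    (hno : ∀ s, (range (n + 1)).image p ⊆ s → Disjoint s H → ¬ G.PathOn s (p 0) (p m))
    {c v : V} (hv : v ∈ H) (hcv : G.dist c v ≤ 2) (hca : G.dist c (p (m - 1)) ≤ 1)
    (hce : G.dist c (p n) ≤ 2) :
    ∃ T : Finset V,
      (∀ y ∈ T, (∃ t, t + 1 < m ∧ G.Adj (p (m - 1)) (p t) ∧ y = p (t + 1)) ∨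
        ∃ t, m < t ∧ t ≤ n ∧ G.Adj (p (m - 1)) (p t) ∧ y = p (t - 1)) ∧
      ∀ M : Finset V, (∀ u ∈ M, G.dist c u ≤ 3 ∧ u ∉ T ∧ ¬ G.Adj (p n) u ∧ u ≠ p n ∧
        ∃ t ≤ n, u = p t) → M.card + 3 ≤ (G.outNbrs H v).card := by
  obtain ⟨hae, T, hT1, hT2⟩ := hp.crossing hm hmn hpH (fun h hh h' => ha h hh h'.symm) hno
  refine ⟨T, hT1, fun M hM => ?_⟩
  have hvn : ∀ i ≤ n, v ≠ p i := fun i hi h => hpH i hi (h ▸ hv)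
  have hdeg := hT c v (p (m - 1)) (p n) hcv (by omega) hce (hvn _ (by omega)) (hvn _ le_rfl)
    (hp.ne (by omega) le_rfl (by omega)) (ha v hv) (he v hv) hae
  have hTp : ∀ y ∈ T, (∃ t ≤ n, y = p t) ∧ G.dist c y ≤ 3 := by
    intro y hy
    rcases hT1 y hy with ⟨t, h1, h2, rfl⟩ | ⟨t, h1, h2, h3, rfl⟩
    · refine ⟨⟨t + 1, by omega, rfl⟩, ?_⟩
      have e1 := hG.dist_le_add hca h2.dist_le_one
      exact hG.dist_le_add e1 (hp.adj t (by omega)).dist_le_one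
    · refine ⟨⟨t - 1, by omega, rfl⟩, ?_⟩
      have e1 := hG.dist_le_add hca h3.dist_le_one
      have e2 := hp.adj (t - 1) (by omega)
      rw [show t - 1 + 1 = t by omega] at e2
      exact hG.dist_le_add e1 e2.symm.dist_le_one
  have hdisj : Disjoint (H ∩ G.ballThree c) M := by
    rw [Finset.disjoint_left]
    intro u hu hu'
    obtain ⟨-, -, -, -, t, ht, rfl⟩ := hM u hu'
    exact hpH t ht (mem_inter.mp hu).1
  have hcount := hT2 (G.ballThree c) (H ∩ G.ballThree c ∪ M)
    (hG.neighborFinset_subset_ballThree (by omega)) (hG.neighborFinset_subset_ballThree hce)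
    (fun y hy => mem_ballThree.mpr (hTp y hy).2) (mem_ballThree.mpr (by omega))
    (union_subset inter_subset_right fun u hu => mem_ballThree.mpr (hM u hu).1) (by
      intro u hu
      rcases mem_union.mp hu with hu | hu
      · have huH := (mem_inter.mp hu).1
        refine ⟨fun h => ?_, fun h => he u huH h.symm, fun h => hpH n le_rfl (h ▸ huH),
          fun h => absurd h.symm (ha u huH)⟩
        obtain ⟨⟨t, ht, rfl⟩, -⟩ := hTp u h
        exact hpH t ht huH
      · obtain ⟨-, h2, h3, h4, h5⟩ := hM u hu
        exact ⟨h2, h3, h4, fun _ => h5⟩)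
  rw [card_union_of_disjoint hdisj] at hcount
  -- the part of `H` in the ball contains `v` and all its neighbours in `H`
  have hv1 : (insert v (G.neighborFinset v ∩ H)).card ≤ (H ∩ G.ballThree c).card := by
    refine card_le_card ?_
    intro u hu
    rcases mem_insert.mp hu with rfl | hu
    · exact mem_inter.mpr ⟨hv, mem_ballThree.mpr (by omega)⟩
    · exact mem_inter.mpr ⟨(mem_inter.mp hu).2,
        hG.neighborFinset_subset_ballThree hcv (mem_inter.mp hu).1⟩
  rw [card_insert_of_notMem (by simp)] at hv1
  have hv2 := card_sdiff_add_card_inter (G.neighborFinset v) H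
  rw [card_neighborFinset_eq_degree] at hv2
  rw [outNbrs]
  omega

/-- If `c` is close to `p (m - 1)` and to `p n`, then the path is reroutable at `p m` as soon as
some vertex of `H` close to `c` has at most two neighbours outside `H`. -/
theorem IsPathMap.exists_reroute (hT : G.TripleCondition) (hG : G.Connected)
    {n m : ℕ} {p : ℕ → V} (hp : G.IsPathMap n p) {H : Finset V} (hm : 1 ≤ m) (hmn : m ≤ n)
    (hpH : ∀ i ≤ n, p i ∉ H) (ha : ∀ h ∈ H, ¬ G.Adj h (p (m - 1)))
    (he : ∀ h ∈ H, ¬ G.Adj h (p n)) {c v : V} (hv : v ∈ H) (hcv : G.dist c v ≤ 2)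
    (hca : G.dist c (p (m - 1)) ≤ 1) (hce : G.dist c (p n) ≤ 2)
    (hk : (G.outNbrs H v).card ≤ 2) :
    ∃ s, (range (n + 1)).image p ⊆ s ∧ Disjoint s H ∧ G.PathOn s (p 0) (p m) := by
  by_contra hcon
  push Not at hcon
  obtain ⟨T, -, h⟩ := hp.card_add_three_le hT hG hm hmn hpH ha he hcon hv hcv hca hce
  have := h ∅ (by simp)
  simp at this
  omega

end Triples

/-! ### Cycles that cannot be enlarged -/

section Stuck

variable {V : Type*} [DecidableEq V]

/-- A vertex outside `H` with a neighbour in `H`. -/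
def Attach (G : SimpleGraph V) (H : Finset V) (w : V) : Prop :=
  w ∉ H ∧ ∃ h ∈ H, G.Adj h w

/-- A closed walk `f` of period `N` without further repetitions, that is, a cycle of length `N`
(or a single edge if `N = 2`), together with a set `H` of vertices off the cycle all of whose
outer neighbours lie on the cycle. The cycle cannot be enlarged through `H`: a path outside `H`
between two distinct vertices attached to `H` has fewer than `N` vertices, and fewer than `N - 1`
vertices if the ends are attached to distinct vertices of `H`. -/
structure IsStuck (G : SimpleGraph V) (H : Finset V) (N : ℕ) (f : ℤ → V) : Prop where
  two_le : 2 ≤ N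
  adj : ∀ i, G.Adj (f i) (f (i + 1))
  dvd : ∀ i j, f i = f j → (N : ℤ) ∣ i - j
  per : ∀ i, f (i + N) = f i
  notMem : ∀ i, f i ∉ H
  out : ∀ h ∈ H, ∀ u, G.Adj h u → u ∉ H → ∃ i, f i = u
  card_lt : ∀ s w w', w ≠ w' → G.Attach H w → G.Attach H w' → G.PathOn s w w' → Disjoint s H →
    s.card < N
  card_add_one_lt : ∀ s w w' h h', w ≠ w' → w ∉ H → w' ∉ H → h ∈ H → h' ∈ H → h ≠ h' →
    G.Adj h w → G.Adj h' w' → G.PathOn s w w' → Disjoint s H → s.card + 1 < N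

open Classical in
/-- The successor of `w` along `f`; it is `w` itself if `w` is not a value of `f`. -/
noncomputable def nxt (f : ℤ → V) (w : V) : V :=
  if h : ∃ i, f i = w then f (h.choose + 1) else w

namespace IsStuck

variable {G : SimpleGraph V} {H : Finset V} {N : ℕ} {f : ℤ → V}

lemma per_mul (hS : G.IsStuck H N f) (i k : ℤ) : f (i + N * k) = f i := by
  induction k with
  | zero => simp
  | succ k ih => rw [mul_add, mul_one, ← add_assoc, hS.per, ih]
  | pred k ih =>
    rw [← ih, ← hS.per (i + N * (-k - 1))]
    congr 1; ring

lemma eq_of_dvd (hS : G.IsStuck H N f) {i j : ℤ} (h : (N : ℤ) ∣ i - j) : f i = f j := by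
  obtain ⟨k, hk⟩ := h
  rw [show i = j + N * k by omega, hS.per_mul]

lemma nxt_apply (hS : G.IsStuck H N f) (i : ℤ) : nxt f (f i) = f (i + 1) := by
  have h : ∃ j, f j = f i := ⟨i, rfl⟩
  rw [nxt, dif_pos h]
  refine hS.eq_of_dvd ?_
  have := hS.dvd _ _ h.choose_spec
  simpa using this

lemma nxt_injOn (hS : G.IsStuck H N f) : Set.InjOn (nxt f) (Set.range f) := by
  rintro _ ⟨i, rfl⟩ _ ⟨j, rfl⟩ h
  rw [hS.nxt_apply, hS.nxt_apply] at h
  refine hS.eq_of_dvd ?_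
  have := hS.dvd _ _ h
  simpa using this

lemma exists_of_attach (hS : G.IsStuck H N f) {w : V} (hw : G.Attach H w) : ∃ i, f i = w := by
  obtain ⟨h1, h, hh, h2⟩ := hw
  exact hS.out h hh w h2 h1

/-- Every vertex of the cycle is found among the `N` vertices preceding a given one. -/
lemma exists_lt (hS : G.IsStuck H N f) (i j : ℤ) : ∃ t : ℕ, t < N ∧ f (j - t) = f i := by
  have hN : (0 : ℤ) < N := by have := hS.two_le; omega
  refine ⟨((j - i) % N).toNat, ?_, hS.eq_of_dvd ?_⟩
  · have := Int.emod_lt_of_pos (j - i) hN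
    have := Int.emod_nonneg (j - i) hN.ne'
    omega
  · have := Int.emod_nonneg (j - i) hN.ne'
    rw [Int.toNat_of_nonneg this]
    have h2 := Int.emod_add_mul_ediv (j - i) N
    exact ⟨(j - i) / N, by linarith⟩

/-- The cycle traversed backwards from `f j` to `f (j + 1)`. -/
lemma isPathMap (hS : G.IsStuck H N f) (j : ℤ) :
    G.IsPathMap (N - 1) (fun t : ℕ => f (j - t)) := by
  have hN := hS.two_le
  refine ⟨?_, ?_⟩
  · intro a ha b hb hab
    simp only [Set.mem_Iic] at ha hb
    obtain ⟨k, hk⟩ := hS.dvd _ _ hab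
    have h1 : (N : ℤ) * k < N * 1 := by omega
    have h2 : (N : ℤ) * (-1) < N * k := by omega
    have h1' := lt_of_mul_lt_mul_left h1 (by omega)
    have h2' := lt_of_mul_lt_mul_left h2 (by omega)
    have : k = 0 := by omega
    subst this
    omega
  · intro t ht
    have := (hS.adj (j - (t + 1 : ℕ))).symm
    rwa [show j - (t + 1 : ℕ) + 1 = j - t by push_cast; ring] at this

lemma ne_of_lt (hS : G.IsStuck H N f) (j : ℤ) {a b : ℕ} (ha : a < N) (hb : b < N) (hab : a ≠ b) :
    f (j - a) ≠ f (j - b) :=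
  (hS.isPathMap j).ne (by omega) (by omega) hab

/-- The set of vertices of the cycle. -/
def verts (N : ℕ) (f : ℤ → V) : Finset V := (range N).image fun t : ℕ => f (-t)

lemma mem_verts (hS : G.IsStuck H N f) {u : V} : u ∈ verts N f ↔ ∃ i, f i = u := by
  simp only [verts, mem_image, mem_range]
  constructor
  · rintro ⟨t, -, rfl⟩; exact ⟨_, rfl⟩
  · rintro ⟨i, rfl⟩
    obtain ⟨t, ht, h⟩ := hS.exists_lt i 0
    exact ⟨t, ht, by simpa using h⟩

lemma image_eq_verts (hS : G.IsStuck H N f) (j : ℤ) :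
    (range (N - 1 + 1)).image (fun t : ℕ => f (j - t)) = verts N f := by
  have hN := hS.two_le
  ext u
  rw [hS.mem_verts]
  simp only [mem_image, mem_range]
  constructor
  · rintro ⟨t, -, rfl⟩; exact ⟨_, rfl⟩
  · rintro ⟨i, rfl⟩
    obtain ⟨t, ht, h⟩ := hS.exists_lt i j
    exact ⟨t, by omega, h⟩

lemma card_verts (hS : G.IsStuck H N f) : (verts N f).card = N := by
  have hN := hS.two_le
  rw [← hS.image_eq_verts 0, card_image_of_injOn]
  · simp; omega
  · intro a ha b hb hab
    exact (hS.isPathMap 0).inj (by simpa [Nat.lt_succ_iff] using ha)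
      (by simpa [Nat.lt_succ_iff] using hb) hab

lemma disjoint_verts (hS : G.IsStuck H N f) : Disjoint (verts N f) H := by
  rw [Finset.disjoint_left]
  intro u hu
  obtain ⟨i, rfl⟩ := hS.mem_verts.mp hu
  exact hS.notMem i

/-- The cycle itself is a path from any of its vertices to the next one. -/
lemma pathOn_verts (hS : G.IsStuck H N f) (j : ℤ) : G.PathOn (verts N f) (f j) (f (j + 1)) := by
  have hN := hS.two_le
  have h := (hS.isPathMap j).pathOn
  rw [hS.image_eq_verts] at h
  have e1 : f (j - ((N - 1 : ℕ) : ℤ)) = f (j + 1) := by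
    refine hS.eq_of_dvd ⟨-1, ?_⟩
    omega
  simpa [e1] using h

/-- No path joining two attached vertices outside `H` contains the cycle. -/
lemma false_of_pathOn (hS : G.IsStuck H N f) {s : Finset V} {w w' : V} (hne : w ≠ w')
    (hw : G.Attach H w) (hw' : G.Attach H w') (hp : G.PathOn s w w') (hd : Disjoint s H)
    (hs : verts N f ⊆ s) : False := by
  have h1 := hS.card_lt s w w' hne hw hw' hp hd
  have h2 := card_le_card hs
  rw [hS.card_verts] at h2
  omega

lemma not_attach_succ (hS : G.IsStuck H N f) {i : ℤ} (hi : G.Attach H (f i)) :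
    ¬ G.Attach H (f (i + 1)) := fun h =>
  hS.false_of_pathOn (hS.adj i).ne hi h (hS.pathOn_verts i) hS.disjoint_verts (Subset.refl _)

lemma not_adj_succ (hS : G.IsStuck H N f) {i : ℤ} (hi : G.Attach H (f i)) :
    ∀ h ∈ H, ¬ G.Adj h (f (i + 1)) := fun h hh hadj =>
  hS.not_attach_succ hi ⟨hS.notMem _, h, hh, hadj⟩

lemma adj_nxt (hS : G.IsStuck H N f) {w : V} (hw : G.Attach H w) : G.Adj w (nxt f w) := by
  obtain ⟨i, rfl⟩ := hS.exists_of_attach hw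
  rw [hS.nxt_apply]
  exact hS.adj i

lemma not_adj_nxt (hS : G.IsStuck H N f) {w : V} (hw : G.Attach H w) :
    ∀ h ∈ H, ¬ G.Adj h (nxt f w) := by
  obtain ⟨i, rfl⟩ := hS.exists_of_attach hw
  rw [hS.nxt_apply]
  exact hS.not_adj_succ hw

lemma nxt_notMem (hS : G.IsStuck H N f) {w : V} (hw : G.Attach H w) : nxt f w ∉ H := by
  obtain ⟨i, rfl⟩ := hS.exists_of_attach hw
  rw [hS.nxt_apply]
  exact hS.notMem _

lemma not_attach_nxt (hS : G.IsStuck H N f) {w : V} (hw : G.Attach H w) :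
    ¬ G.Attach H (nxt f w) := fun ⟨_, h, hh, h'⟩ => hS.not_adj_nxt hw h hh h'

lemma nxt_ne (hS : G.IsStuck H N f) {w w' : V} (hw : G.Attach H w) (hw' : G.Attach H w')
    (hne : w ≠ w') : nxt f w ≠ nxt f w' := fun h =>
  hne (hS.nxt_injOn (hS.exists_of_attach hw) (hS.exists_of_attach hw') h)

/-- Two distinct attached vertices, in the form in which the crossing lemma is applied: the cycle
is read backwards from the second one. -/
lemma exists_index (hS : G.IsStuck H N f) {w w' : V} (hw : G.Attach H w) (hw' : G.Attach H w')
    (hne : w ≠ w') : ∃ (j : ℤ) (m : ℕ), 1 ≤ m ∧ m < N ∧ f j = w' ∧ f (j - m) = w := by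
  obtain ⟨i, rfl⟩ := hS.exists_of_attach hw
  obtain ⟨j, rfl⟩ := hS.exists_of_attach hw'
  obtain ⟨m, hm, h⟩ := hS.exists_lt i j
  refine ⟨j, m, ?_, hm, rfl, h⟩
  rcases Nat.eq_zero_or_pos m with rfl | h0
  · simp at h
    exact absurd h.symm hne
  · exact h0

/-- The cycle, read backwards from an attached vertex, cannot be rerouted into a path between two
attached vertices. -/
lemma no_reroute (hS : G.IsStuck H N f) {j : ℤ} {m : ℕ} (hm : 1 ≤ m) (hmN : m < N)
    (hj : G.Attach H (f j)) (hjm : G.Attach H (f (j - m))) :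
    ∀ s, (range (N - 1 + 1)).image (fun t : ℕ => f (j - t)) ⊆ s → Disjoint s H →
      ¬ G.PathOn s (f (j - (0 : ℕ))) (f (j - m)) := by
  intro s hs hd hp
  rw [hS.image_eq_verts] at hs
  refine hS.false_of_pathOn ?_ ?_ hjm hp hd hs
  · exact hS.ne_of_lt j (by omega) hmN (by omega)
  · simpa using hj

variable [Fintype V] [DecidableRel G.Adj]

/-- The crossing lemma for the successors `f (j - m + 1)` and `f (j + 1)` of two attached
vertices `f (j - m)` and `f j` of the cycle. -/
theorem crossing (hS : G.IsStuck H N f) {j : ℤ} {m : ℕ} (hm : 1 ≤ m) (hmN : m < N)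
    (hj : G.Attach H (f j)) (hjm : G.Attach H (f (j - m))) :
    ¬ G.Adj (f (j - m + 1)) (f (j + 1)) ∧ ∃ T : Finset V,
      (∀ y ∈ T, (∃ t : ℕ, t + 1 < m ∧ G.Adj (f (j - m + 1)) (f (j - t)) ∧ y = f (j - t - 1)) ∨
        ∃ t : ℕ, m < t ∧ t < N ∧ G.Adj (f (j - m + 1)) (f (j - t)) ∧ y = f (j - t + 1)) ∧
      ∀ D M : Finset V, G.neighborFinset (f (j - m + 1)) ⊆ D → G.neighborFinset (f (j + 1)) ⊆ D →
        T ⊆ D → f (j + 1) ∈ D → M ⊆ D →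
        (∀ u ∈ M, u ∉ T ∧ ¬ G.Adj (f (j + 1)) u ∧ u ≠ f (j + 1) ∧
          (G.Adj (f (j - m + 1)) u → ∃ i, f i = u)) →
        G.degree (f (j - m + 1)) + G.degree (f (j + 1)) + M.card ≤ D.card := by
  -- the path `t ↦ f (j - t)` has `f (j - m + 1)` just before `f (j - m)`, and ends in `f (j + 1)`
  have e1 : f (j - ((N - 1 : ℕ) : ℤ)) = f (j + 1) := hS.eq_of_dvd ⟨-1, by omega⟩
  have e2 : f (j - ((m - 1 : ℕ) : ℤ)) = f (j - m + 1) := by congr 1; omega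
  have ha : ∀ h ∈ H, ¬ G.Adj (f (j - ((m - 1 : ℕ) : ℤ))) h := by
    intro h hh
    rw [e2]
    exact fun h' => hS.not_adj_succ hjm h hh h'.symm
  obtain ⟨h1, T, h2, h3⟩ := (hS.isPathMap j).crossing (H := H) hm (by omega)
    (fun i _ => hS.notMem _) ha (hS.no_reroute hm hmN hj hjm)
  rw [e2] at h2
  rw [e1, e2] at h1 h3
  refine ⟨h1, T, ?_, ?_⟩
  · intro y hy
    rcases h2 y hy with ⟨t, h4, h5, rfl⟩ | ⟨t, h4, h5, h6, rfl⟩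
    · exact Or.inl ⟨t, h4, h5, by congr 1; push_cast; ring⟩
    · exact Or.inr ⟨t, h4, by omega, h6, by congr 1; omega⟩
  · intro D M d1 d2 d3 d4 d5 hM
    refine h3 D M d1 d2 d3 d4 d5 fun u hu => ?_
    obtain ⟨m1, m2, m3, m4⟩ := hM u hu
    refine ⟨m1, m2, m3, fun h => ?_⟩
    obtain ⟨i, rfl⟩ := m4 h
    obtain ⟨t, ht, h⟩ := hS.exists_lt i j
    exact ⟨t, by omega, h.symm⟩

lemma not_adj_nxt_nxt (hS : G.IsStuck H N f) {w w' : V} (hw : G.Attach H w) (hw' : G.Attach H w') :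
    ¬ G.Adj (nxt f w) (nxt f w') := by
  by_cases hne : w = w'
  · subst hne; simp
  obtain ⟨j, m, h1, h2, rfl, rfl⟩ := hS.exists_index hw hw' hne
  rw [hS.nxt_apply, hS.nxt_apply]
  exact (hS.crossing h1 h2 hw' hw).1

/-- The crossing lemma on the cycle combined with the degree condition for the triple consisting
of `v ∈ H` and two successors of attached vertices. -/
theorem card_add_three_le (hS : G.IsStuck H N f) (hT : G.TripleCondition) (hG : G.Connected)
    {j : ℤ} {m : ℕ} (hm : 1 ≤ m) (hmN : m < N)
    (hj : G.Attach H (f j)) (hjm : G.Attach H (f (j - m))) {c v : V} (hv : v ∈ H)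
    (hcv : G.dist c v ≤ 2) (hca : G.dist c (f (j - m + 1)) ≤ 1) (hce : G.dist c (f (j + 1)) ≤ 2) :
    ∃ T : Finset V,
      (∀ y ∈ T, (∃ t : ℕ, t + 1 < m ∧ G.Adj (f (j - m + 1)) (f (j - t)) ∧ y = f (j - t - 1)) ∨
        ∃ t : ℕ, m < t ∧ t < N ∧ G.Adj (f (j - m + 1)) (f (j - t)) ∧ y = f (j - t + 1)) ∧
      ∀ M : Finset V, (∀ u ∈ M, G.dist c u ≤ 3 ∧ u ∉ T ∧ ¬ G.Adj (f (j + 1)) u ∧ u ≠ f (j + 1) ∧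
        ∃ i, f i = u) → M.card + 3 ≤ (G.outNbrs H v).card := by
  have e1 : f (j - ((N - 1 : ℕ) : ℤ)) = f (j + 1) := hS.eq_of_dvd ⟨-1, by omega⟩
  have e2 : f (j - ((m - 1 : ℕ) : ℤ)) = f (j - m + 1) := by congr 1; omega
  obtain ⟨T, h2, h3⟩ := (hS.isPathMap j).card_add_three_le hT hG (H := H) hm (by omega)
    (fun i _ => hS.notMem _) (by simp only [e2]; exact hS.not_adj_succ hjm)
    (by simp only [e1]; exact hS.not_adj_succ hj) (hS.no_reroute hm hmN hj hjm) hv hcv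
    (by simpa only [e2] using hca) (by simpa only [e1] using hce)
  simp only [e1, e2] at h2 h3
  refine ⟨T, ?_, ?_⟩
  · intro y hy
    rcases h2 y hy with ⟨t, h4, h5, rfl⟩ | ⟨t, h4, h5, h6, rfl⟩
    · exact Or.inl ⟨t, h4, h5, by congr 1; push_cast; ring⟩
    · exact Or.inr ⟨t, h4, by omega, h6, by congr 1; omega⟩
  · intro M hM
    refine h3 M fun u hu => ?_
    obtain ⟨m0, m1, m2, m3, i, rfl⟩ := hM u hu
    obtain ⟨t, ht, h⟩ := hS.exists_lt i j
    exact ⟨m0, m1, m2, m3, t, by omega, h.symm⟩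

/-- A vertex of `H` with at most two neighbours outside `H` is not close to the successors of two
attached vertices. -/
theorem three_le_card_outNbrs (hS : G.IsStuck H N f) (hT : G.TripleCondition) (hG : G.Connected)
    {w w' : V} (hw : G.Attach H w) (hw' : G.Attach H w') (hne : w ≠ w') {c v : V} (hv : v ∈ H)
    (hcv : G.dist c v ≤ 2) (hca : G.dist c (nxt f w) ≤ 1) (hce : G.dist c (nxt f w') ≤ 2) :
    3 ≤ (G.outNbrs H v).card := by
  obtain ⟨j, m, h1, h2, rfl, rfl⟩ := hS.exists_index hw hw' hne
  rw [hS.nxt_apply] at hca hce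
  obtain ⟨T, -, h⟩ := hS.card_add_three_le hT hG h1 h2 hw' hw hv hcv hca hce
  simpa using h ∅ (by simp)

end IsStuck

end Stuck

/-! ### Rerouting the cycle near a fixed vertex -/

lemma IsPathMap.snoc {V : Type*} {G : SimpleGraph V} {n : ℕ} {p : ℕ → V} (hp : G.IsPathMap n p)
    {y : V} (hy : ∀ i ≤ n, p i ≠ y) (hadj : G.Adj (p n) y) :
    G.IsPathMap (n + 1) (fun t => if t ≤ n then p t else y) := by
  refine ⟨?_, ?_⟩
  · intro a ha b hb hab
    simp only [Set.mem_Iic] at ha hb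
    by_cases h1 : a ≤ n <;> by_cases h2 : b ≤ n <;> simp only [h1, h2, if_true, if_false] at hab
    · exact hp.inj h1 h2 hab
    · exact absurd hab (hy a h1)
    · exact absurd hab.symm (hy b h2)
    · omega
  · intro i hi
    rcases Nat.lt_succ_iff_lt_or_eq.mp hi with h | h
    · simp only [h.le, show i + 1 ≤ n by omega, if_true]
      exact hp.adj i h
    · subst h
      simpa using hadj

/-- Every ball of radius three minus its centre is connected: a set separating two of its
vertices is crossed by an edge inside the punctured ball. -/
def PuncturedBallsConnected {V : Type*} (G : SimpleGraph V) : Prop :=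
  ∀ (w a b : V) (Z : Set V), a ∈ Z → b ∉ Z → a ≠ w → b ≠ w → G.dist w a ≤ 3 → G.dist w b ≤ 3 →
    ∃ u y, u ∈ Z ∧ y ∉ Z ∧ G.Adj u y ∧ u ≠ w ∧ y ≠ w ∧ G.dist w u ≤ 3 ∧ G.dist w y ≤ 3

section Local

variable {V : Type*} [Fintype V] [DecidableEq V] {G : SimpleGraph V} [DecidableRel G.Adj]
  {H : Finset V} {N : ℕ} {f : ℤ → V}

lemma inter_eq_empty_of_three_le_dist (hG : G.Connected) {a b : V} (h : 3 ≤ G.dist a b) :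
    G.neighborFinset a ∩ G.neighborFinset b = ∅ := by
  rw [← disjoint_iff_inter_eq_empty, Finset.disjoint_left]
  intro u hu hu'
  rw [mem_neighborFinset] at hu hu'
  have := hG.dist_le_add hu.dist_le_one hu'.symm.dist_le_one
  omega

lemma inter_subset_outNbrs {v x : V} (hx : ∀ h ∈ H, ¬ G.Adj h x) :
    G.neighborFinset v ∩ G.neighborFinset x ⊆ G.outNbrs H v := by
  intro u hu
  simp only [mem_inter, mem_neighborFinset] at hu
  exact mem_outNbrs.mpr ⟨hu.1, fun h => hx u h hu.2.symm⟩

lemma attach_of_mem_outNbrs {v w : V} (hv : v ∈ H) (hw : w ∈ G.outNbrs H v) : G.Attach H w :=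
  ⟨(mem_outNbrs.mp hw).2, v, hv, (mem_outNbrs.mp hw).1⟩

namespace IsStuck

lemma dist_nxt_le_two (hS : G.IsStuck H N f) (hG : G.Connected) {v w : V} (hv : v ∈ H)
    (hw : w ∈ G.outNbrs H v) : G.dist v (nxt f w) ≤ 2 :=
  hG.dist_le_add (mem_outNbrs.mp hw).1.dist_le_one
    (hS.adj_nxt (attach_of_mem_outNbrs hv hw)).dist_le_one

omit [Fintype V] [DecidableRel G.Adj] in
lemma ne_nxt (hS : G.IsStuck H N f) {v w : V} (hv : v ∈ H) (hw : G.Attach H w) :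
    v ≠ nxt f w := fun h => hS.nxt_notMem hw (h ▸ hv)

/-- Rerouting the cycle twice, first near `w` and then near `w'`, leads to a path from `w` to
`w'` through all vertices of the cycle. The vertex `y` is the place where the cycle is opened:
it is near `w` and adjacent to `w'`. -/
theorem false_of_two_reroutes (hS : G.IsStuck H N f) (hT : G.TripleCondition) (hG : G.Connected)
    {w w' y : V} (hw : G.Attach H w) (hw' : G.Attach H w') (hne : w ≠ w') (hyH : y ∉ H)
    (hya : ¬ G.Attach H y) (hy : G.Adj w' y) {c v v' : V} (hv : v ∈ H)
    (hkv : (G.outNbrs H v).card ≤ 2) (hcv : G.dist c v ≤ 2) (hcw : G.dist c (nxt f w) ≤ 1)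
    (hcy : G.dist c y ≤ 2) (hv' : v' ∈ H) (hkv' : (G.outNbrs H v').card ≤ 2)
    (hcv' : G.dist w' v' ≤ 2) (hN : ∀ u, G.Adj w' u → ¬ G.Attach H u) : False := by
  have hN2 := hS.two_le
  have hHy : ∀ h ∈ H, ¬ G.Adj h y := fun h hh h' => hya ⟨hyH, h, hh, h'⟩
  -- The first rerouting, of the cycle opened just before `y` if `y` lies on it, or opened just
  -- before `w'` and prolonged by the edge from `w'` to `y` otherwise.
  obtain ⟨s, e, hs, hsH, hp, hde, hew⟩ : ∃ (s : Finset V) (e : V), verts N f ⊆ s ∧ Disjoint s H ∧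
      G.PathOn s e w ∧ G.dist w' e ≤ 2 ∧ e ≠ w := by
    by_cases hyC : ∃ j, f j = y
    · obtain ⟨j, rfl⟩ := hyC
      obtain ⟨i, rfl⟩ := hS.exists_of_attach hw
      obtain ⟨m, hm, hmi⟩ := hS.exists_lt i (j - 1)
      have e1 : f (j - 1 - ((N - 1 : ℕ) : ℤ)) = f j := hS.eq_of_dvd ⟨-1, by omega⟩
      have hpath := hS.isPathMap (j - 1)
      rcases Nat.eq_zero_or_pos m with rfl | hm0
      · have h1 : f (j - 1) = f i := by simpa using hmi
        have h2 := hS.pathOn_verts (j - 1)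
        rw [sub_add_cancel, h1] at h2
        exact ⟨verts N f, f j, Subset.refl _, hS.disjoint_verts, h2.symm,
          hy.dist_le_one.trans (by omega), fun h => hya (h ▸ hw)⟩
      · have e2 : f (j - 1 - ((m - 1 : ℕ) : ℤ)) = nxt f (f i) := by
          rw [← hmi, hS.nxt_apply]; congr 1; omega
        obtain ⟨s, h1, h2, h3⟩ := hpath.exists_reroute hT hG (H := H) (m := m) hm0 (by omega)
          (fun i _ => hS.notMem _) (by simp only [e2]; exact hS.not_adj_nxt hw)
          (by simp only [e1]; exact hHy) hv hcv (by simp only [e2]; exact hcw)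
          (by simp only [e1]; exact hcy) hkv
        rw [hS.image_eq_verts] at h1
        simp only [hmi] at h3
        refine ⟨s, _, h1, h2, h3, ?_, ?_⟩
        · have h4 := hS.adj (j - 1)
          rw [sub_add_cancel] at h4
          simpa using hG.dist_le_add hy.dist_le_one h4.symm.dist_le_one
        · rw [← hmi]
          exact hS.ne_of_lt (j - 1) (by omega) hm (by omega)
    · obtain ⟨i, rfl⟩ := hS.exists_of_attach hw
      obtain ⟨j, rfl⟩ := hS.exists_of_attach hw'
      obtain ⟨m, hm, hmi⟩ := hS.exists_lt i (j - 1)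
      have e1 : f (j - 1 - ((N - 1 : ℕ) : ℤ)) = f j := hS.eq_of_dvd ⟨-1, by omega⟩
      have hm0 : 1 ≤ m := by
        rcases Nat.eq_zero_or_pos m with rfl | hm0
        · exfalso
          have h1 : f (j - 1) = f i := by simpa using hmi
          have h2 := hS.not_attach_succ (i := j - 1) (h1 ▸ hw)
          rw [sub_add_cancel] at h2
          exact h2 hw'
        · exact hm0
      have e2 : f (j - 1 - ((m - 1 : ℕ) : ℤ)) = nxt f (f i) := by
        rw [← hmi, hS.nxt_apply]; congr 1; omega
      have hpath := (hS.isPathMap (j - 1)).snoc (y := y) (fun i _ h => hyC ⟨_, h⟩)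
        (by simp only [e1]; exact hy)
      have hn : ¬ (N - 1 + 1 ≤ N - 1) := by omega
      have hm1 : m - 1 ≤ N - 1 := by omega
      have hm2 : m ≤ N - 1 := by omega
      obtain ⟨s, h1, h2, h3⟩ := hpath.exists_reroute hT hG (H := H) (m := m) hm0 (by omega)
        (fun i _ => by
          by_cases h : i ≤ N - 1
          · simp only [h, if_true]; exact hS.notMem _
          · simp only [h, if_false]; exact hyH)
        (by simp only [hm1, if_true, e2]; exact hS.not_adj_nxt hw)
        (by simp only [hn, if_false]; exact hHy) hv hcv
        (by simp only [hm1, if_true, e2]; exact hcw) (by simp only [hn, if_false]; exact hcy) hkv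
      simp only [hm2, if_true, hmi, Nat.zero_le] at h3
      refine ⟨s, _, ?_, h2, h3, ?_, ?_⟩
      · rw [← hS.image_eq_verts (j - 1)]
        intro u hu
        obtain ⟨t, ht, rfl⟩ := mem_image.mp hu
        have ht' := mem_range.mp ht
        refine h1 (mem_image.mpr ⟨t, by simp; omega, ?_⟩)
        simp only [show t ≤ N - 1 by omega, if_true]
      · have h4 := hS.adj (j - 1)
        rw [sub_add_cancel] at h4
        simpa using h4.symm.dist_le_one.trans (by omega)
      · rw [← hmi]
        exact hS.ne_of_lt (j - 1) (by omega) hm (by omega)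
  -- the second rerouting, of the resulting path from `w` to `e`, near `w'`
  have heA : ¬ G.Attach H e := fun h => hS.false_of_pathOn hew h hw hp hsH hs
  have hsH' : ∀ u ∈ s, u ∉ H := fun u hu => Finset.disjoint_left.mp hsH hu
  obtain ⟨n, p, hpm, h0, hn, him⟩ := hp.symm.exists_isPathMap
  have hmem : ∀ t ≤ n, p t ∈ s := fun t ht => him ▸ mem_image_of_mem p (by simp; omega)
  have hw's : w' ∈ s := hs (hS.mem_verts.mpr (hS.exists_of_attach hw'))
  rw [← him] at hw's
  obtain ⟨m, hm, hmw⟩ := mem_image.mp hw's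
  rw [mem_range, Nat.lt_succ_iff] at hm
  have hm0 : 1 ≤ m := by
    rcases Nat.eq_zero_or_pos m with rfl | h
    · exact absurd (h0.symm.trans hmw) hne
    · exact h
  have hadj := hpm.adj (m - 1) (by omega)
  rw [show m - 1 + 1 = m by omega, hmw] at hadj
  obtain ⟨s', h1, h2, h3⟩ := hpm.exists_reroute hT hG (H := H) hm0 hm
    (fun t ht => hsH' _ (hmem t ht))
    (fun h hh h' => hN _ hadj.symm ⟨hsH' _ (hmem _ (by omega)), h, hh, h'⟩)
    (by rw [hn]; exact fun h hh h' => heA ⟨hsH' _ hp.left_mem, h, hh, h'⟩) hv' hcv'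
    hadj.symm.dist_le_one (by rw [hn]; exact hde) hkv'
  rw [h0, hmw] at h3
  rw [him] at h1
  exact hS.false_of_pathOn hne hw hw' h3 h2 (hs.trans h1)

/-- If a vertex of `H` has a single neighbour `w` outside `H`, then the other attached vertices
are far away from `w`. -/
lemma three_le_dist (hS : G.IsStuck H N f) (hT : G.TripleCondition) (hG : G.Connected)
    {v w w' : V} (hv : v ∈ H) (hw : w ∈ G.outNbrs H v) (hk : (G.outNbrs H v).card ≤ 1)
    (hw' : G.Attach H w') (hne : w ≠ w') : 3 ≤ G.dist w w' := by
  by_contra hlt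
  have hwA := attach_of_mem_outNbrs hv hw
  obtain ⟨u, hu1, hu2⟩ := hG.exists_dist_le_of_dist_le_add (i := 1) (j := 1)
    (show G.dist w w' ≤ 1 + 1 by omega)
  have hwx := hS.adj_nxt hwA
  have hwx' := hS.adj_nxt hw'
  have hvw := (mem_outNbrs.mp hw).1
  have huniq : G.outNbrs H v ⊆ {w} := fun z hz =>
    mem_singleton.mpr (card_le_one.mp hk z hz w hw)
  have hd : 3 ≤ G.dist (nxt f w) (nxt f w') := by
    by_contra hd
    have := hS.three_le_card_outNbrs hT hG hwA hw' hne (c := nxt f w) hv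
      (by rw [dist_comm]; exact hS.dist_nxt_le_two hG hv hw) (by simp) (by omega)
    omega
  have hu1' : G.dist u w ≤ 1 := by rwa [dist_comm]
  have h := hT.card_add_two_le hG (c := u) (a := v) (b := nxt f w) (d := nxt f w')
    (hG.dist_le_add hu1' hvw.symm.dist_le_one) (hG.dist_le_add hu1' hwx.dist_le_one)
    (hG.dist_le_add hu2 hwx'.dist_le_one) (hS.ne_nxt hv hwA) (hS.ne_nxt hv hw')
    (hS.nxt_ne hwA hw' hne) (hS.not_adj_nxt hwA v hv) (hS.not_adj_nxt hw' v hv)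
    (hS.not_adj_nxt_nxt hwA hw') (R := ∅) (by simp)
  have h1 : (G.neighborFinset v ∩ G.neighborFinset (nxt f w)).card ≤ 1 :=
    (card_le_card ((inter_subset_outNbrs (hS.not_adj_nxt hwA)).trans huniq)).trans (by simp)
  have h2 : G.neighborFinset v ∩ G.neighborFinset (nxt f w') = ∅ := by
    rw [eq_empty_iff_forall_notMem]
    intro z hz
    have hzw := mem_singleton.mp (huniq (inter_subset_outNbrs (hS.not_adj_nxt hw') hz))
    subst hzw
    have h3 := (mem_neighborFinset _ _ _).mp (mem_inter.mp hz).2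
    have := hG.dist_le_add hwx.symm.dist_le_one h3.symm.dist_le_one
    omega
  rw [h2, inter_eq_empty_of_three_le_dist hG hd] at h
  simp at h
  omega

/-- Not every vertex of `H` has at most one neighbour outside `H`. -/
theorem exists_two_le_card_outNbrs (hS : G.IsStuck H N f) (hT : G.TripleCondition)
    (hG : G.Connected) (hP : G.PuncturedBallsConnected) {w : V} (hw : G.Attach H w) :
    ∃ v ∈ H, 2 ≤ (G.outNbrs H v).card := by
  by_contra hcon
  push Not at hcon
  obtain ⟨hwH, v, hv, hvw⟩ := id hw
  have hwv : w ∈ G.outNbrs H v := mem_outNbrs.mpr ⟨hvw, hwH⟩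
  have hk : (G.outNbrs H v).card ≤ 1 := by have := hcon v hv; omega
  have huniq : ∀ z ∈ G.outNbrs H v, z = w := fun z hz => card_le_one.mp hk z hz w hwv
  have hwx := hS.adj_nxt hw
  set x := nxt f w with hx
  have hxv : G.dist x v ≤ 2 := hG.dist_le_add hwx.symm.dist_le_one hvw.symm.dist_le_one
  -- vertices at distance two or three from `w` are near `v` or near `x`
  have hnear : ∀ u, 2 ≤ G.dist w u → G.dist w u ≤ 3 → G.dist v u ≤ 2 ∨ G.dist x u ≤ 2 := by
    intro u hu2 hu3
    by_contra hfar
    push Not at hfar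
    obtain ⟨p, hp1, hp2⟩ := hG.exists_dist_le_of_dist_le_add (i := 1) (j := 2)
      (show G.dist w u ≤ 1 + 2 by omega)
    have hp1' : G.dist p w ≤ 1 := by rwa [dist_comm]
    have h := hT.card_add_two_le hG (c := p) (a := v) (b := x) (d := u)
      (hG.dist_le_add hp1' hvw.symm.dist_le_one) (hG.dist_le_add hp1' hwx.dist_le_one) hp2
      (hS.ne_nxt hv hw) (ne_of_one_le_dist (show 1 ≤ G.dist v u by omega))
      (ne_of_one_le_dist (show 1 ≤ G.dist x u by omega))
      (hS.not_adj_nxt hw v hv) (not_adj_of_two_le_dist (by omega))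
      (not_adj_of_two_le_dist (by omega)) (R := ∅) (by simp)
    have h1 : (G.neighborFinset v ∩ G.neighborFinset x).card ≤ 1 :=
      (card_le_card (inter_subset_outNbrs (hS.not_adj_nxt hw))).trans hk
    rw [inter_eq_empty_of_three_le_dist hG (show 3 ≤ G.dist v u by omega),
      inter_eq_empty_of_three_le_dist hG (show 3 ≤ G.dist x u by omega)] at h
    simp at h
    omega
  -- an edge of the punctured ball around `w` leaving the set of vertices in or attached to `H`
  obtain ⟨w', y, hw'Z, hyZ, hadj, hw'w, hyw, -, hy3⟩ := hP w v x {z | z ∈ H ∨ G.Attach H z}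
    (Or.inl hv) (by rintro (h | h); exacts [hS.nxt_notMem hw h, hS.not_attach_nxt hw h])
    (fun h => hwH (h ▸ hv)) hwx.ne' (hvw.symm.dist_le_one.trans (by omega))
    (hwx.dist_le_one.trans (by omega))
  simp only [Set.mem_ofPred_eq, not_or] at hw'Z hyZ
  have hw'A : G.Attach H w' := by
    rcases hw'Z with h | h
    · exact absurd ⟨hyZ.1, w', h, hadj⟩ hyZ.2
    · exact h
  obtain ⟨hw'H, v', hv', hv'w'⟩ := id hw'A
  have hk' : (G.outNbrs H v').card ≤ 1 := by have := hcon v' hv'; omega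
  have hxy : G.dist x y ≤ 2 := by
    by_cases hd : G.dist w y ≤ 1
    · exact hG.dist_le_add hwx.symm.dist_le_one hd
    rcases hnear y (by omega) hy3 with h | h
    · exfalso
      have hne : v ≠ y := fun h => hyZ.1 (h ▸ hv)
      have hnadj : ¬ G.Adj v y := fun h => hyZ.2 ⟨hyZ.1, v, hv, h⟩
      have h2 := hG.two_le_dist hne hnadj
      obtain ⟨g, hg1, hg2⟩ := hG.exists_common_neighbor (show G.dist v y = 2 by omega)
      by_cases hgH : g ∈ H
      · exact hyZ.2 ⟨hyZ.1, g, hgH, hg2⟩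
      · have := huniq g (mem_outNbrs.mpr ⟨hg1, hgH⟩)
        subst this
        exact hd hg2.dist_le_one
    · exact h
  refine hS.false_of_two_reroutes hT hG hw hw'A hw'w.symm hyZ.1 hyZ.2 hadj (c := x) hv (by omega)
    hxv (by simp [hx]) hxy hv' (by omega) (hv'w'.symm.dist_le_one.trans (by omega)) ?_
  intro u hu huA
  have := hS.three_le_dist hT hG hv' (mem_outNbrs.mpr ⟨hv'w', hw'H⟩) hk' huA hu.ne
  have := hu.dist_le_one
  omega

omit [Fintype V] [DecidableRel G.Adj] in
lemma image_nxt_card (hS : G.IsStuck H N f) {A : Finset V} (hA : ∀ w ∈ A, G.Attach H w) :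
    (A.image (nxt f)).card = A.card :=
  card_image_of_injOn fun _ ha _ hb h =>
    hS.nxt_injOn (hS.exists_of_attach (hA _ ha)) (hS.exists_of_attach (hA _ hb)) h

/-- The successors of the neighbours of `v ∈ H` have pairwise distance at most two. -/
lemma dist_nxt_nxt_le_two (hS : G.IsStuck H N f) (hT : G.TripleCondition) (hG : G.Connected)
    {v w w' : V} (hv : v ∈ H) (hw : w ∈ G.outNbrs H v) (hw' : w' ∈ G.outNbrs H v) :
    G.dist (nxt f w) (nxt f w') ≤ 2 := by
  by_cases hne : w = w'
  · subst hne; simp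
  by_contra hd
  have hwA := attach_of_mem_outNbrs hv hw
  have hwA' := attach_of_mem_outNbrs hv hw'
  have hA : ∀ u ∈ G.outNbrs H v, G.Attach H u := fun u hu => attach_of_mem_outNbrs hv hu
  have h := hT.card_add_two_le hG (c := v) (a := v) (b := nxt f w) (d := nxt f w')
    (by simp) (hS.dist_nxt_le_two hG hv hw) (hS.dist_nxt_le_two hG hv hw')
    (hS.ne_nxt hv hwA) (hS.ne_nxt hv hwA') (hS.nxt_ne hwA hwA' hne)
    (hS.not_adj_nxt hwA v hv) (hS.not_adj_nxt hwA' v hv) (hS.not_adj_nxt_nxt hwA hwA')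
    (R := insert v ((G.outNbrs H v).image (nxt f))) (by
      intro u hu
      rcases mem_insert.mp hu with rfl | hu
      · exact ⟨by simp, by simp, fun h => hS.not_adj_nxt hwA u hv h.symm,
          fun h => hS.not_adj_nxt hwA' u hv h.symm⟩
      · obtain ⟨z, hz, rfl⟩ := mem_image.mp hu
        exact ⟨(hS.dist_nxt_le_two hG hv hz).trans (by omega), hS.not_adj_nxt (hA z hz) v hv,
          hS.not_adj_nxt_nxt hwA (hA z hz), hS.not_adj_nxt_nxt hwA' (hA z hz)⟩)
  rw [card_insert_of_notMem (fun h => by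
    obtain ⟨z, hz, h⟩ := mem_image.mp h
    exact hS.ne_nxt hv (hA z hz) h.symm), hS.image_nxt_card hA,
    inter_eq_empty_of_three_le_dist hG (show 3 ≤ G.dist (nxt f w) (nxt f w') by omega)] at h
  have hdisj : Disjoint (G.neighborFinset v ∩ G.neighborFinset (nxt f w))
      (G.neighborFinset v ∩ G.neighborFinset (nxt f w')) := by
    have h1 := inter_eq_empty_of_three_le_dist hG (show 3 ≤ G.dist (nxt f w) (nxt f w') by omega)
    rw [← disjoint_iff_inter_eq_empty] at h1
    exact h1.mono inter_subset_right inter_subset_right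
  have h2 := card_le_card (union_subset (inter_subset_outNbrs (v := v) (hS.not_adj_nxt hwA))
    (inter_subset_outNbrs (v := v) (hS.not_adj_nxt hwA')))
  rw [card_union_of_disjoint hdisj] at h2
  simp at h
  omega

/-- If `v ∈ H` has at least two neighbours outside `H`, then these have no other neighbours in
`H`. -/
theorem not_adj_of_mem_outNbrs (hS : G.IsStuck H N f) (hT : G.TripleCondition) (hG : G.Connected)
    {v w h : V} (hv : v ∈ H) (hk : 2 ≤ (G.outNbrs H v).card) (hw : w ∈ G.outNbrs H v)
    (hh : h ∈ H) (hne : h ≠ v) : ¬ G.Adj h w := by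
  intro hadj
  have hA : ∀ u ∈ G.outNbrs H v, G.Attach H u := fun u hu => attach_of_mem_outNbrs hv hu
  obtain ⟨i, rfl⟩ := hS.exists_of_attach (hA w hw)
  have hidx : ∀ u ∈ G.outNbrs H v, u ≠ f i → ∃ t : ℕ, 1 ≤ t ∧ t < N ∧ f (i - t) = u := by
    intro u hu hui
    obtain ⟨k, rfl⟩ := hS.exists_of_attach (hA u hu)
    obtain ⟨t, ht, h1⟩ := hS.exists_lt k i
    refine ⟨t, ?_, ht, h1⟩
    rcases Nat.eq_zero_or_pos t with rfl | h0
    · exact absurd (by simpa using h1.symm) hui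
    · exact h0
  -- The last neighbour `f j` of `v` before `f i` on the cycle. The successors of the remaining
  -- neighbours of `v` serve as the additional set `M`.
  have hex : ∃ t : ℕ, 1 ≤ t ∧ t < N ∧ f (i - t) ∈ G.outNbrs H v := by
    obtain ⟨u, hu, hui⟩ := exists_mem_ne (show 1 < (G.outNbrs H v).card by omega) (f i)
    obtain ⟨t, h1, h2, rfl⟩ := hidx u hu hui
    exact ⟨t, h1, h2, hu⟩
  classical
  set r := Nat.find hex with hr
  obtain ⟨hr1, hrN, hrv⟩ : 1 ≤ r ∧ r < N ∧ f (i - r) ∈ G.outNbrs H v := Nat.find_spec hex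
  have hmin : ∀ t : ℕ, 1 ≤ t → t < N → f (i - t) ∈ G.outNbrs H v → r ≤ t := fun t h1 h2 h3 =>
    Nat.find_min' hex ⟨h1, h2, h3⟩
  set j : ℤ := i - r with hj
  set m : ℕ := N - r with hm
  have hfi : f (j - m) = f i := hS.eq_of_dvd ⟨-1, by omega⟩
  have hfi1 : f (j - m + 1) = nxt f (f i) := by rw [← hS.nxt_apply, hfi]
  have hfj1 : f (j + 1) = nxt f (f j) := (hS.nxt_apply j).symm
  have hjA := hA _ hrv
  obtain ⟨T, hT1, hT2⟩ := hS.card_add_three_le hT hG (j := j) (m := m) (by omega) (by omega)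
    hjA (hfi ▸ hA _ hw) (c := f (j - m + 1)) hv
    (by rw [hfi1, dist_comm]; exact hS.dist_nxt_le_two hG hv hw) (by simp)
    (by rw [hfi1, hfj1]; exact hS.dist_nxt_nxt_le_two hT hG hv hw hrv)
  set M : Finset V := (((G.outNbrs H v).erase (f i)).erase (f j)).image (nxt f) with hM
  have hMcard : (G.outNbrs H v).card ≤ M.card + 2 := by
    rw [hM, hS.image_nxt_card (fun u hu => hA u (mem_of_mem_erase (mem_of_mem_erase hu)))]
    have h1 := pred_card_le_card_erase (s := G.outNbrs H v) (a := f i)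
    have h2 := pred_card_le_card_erase (s := (G.outNbrs H v).erase (f i)) (a := f j)
    omega
  have := hT2 M (by
    intro u hu
    obtain ⟨z, hz, rfl⟩ := mem_image.mp hu
    obtain ⟨hzj, hzi, hz⟩ := by simpa only [mem_erase] using hz
    refine ⟨?_, ?_, ?_, ?_, ?_⟩
    · rw [hfi1]
      exact (hS.dist_nxt_nxt_le_two hT hG hv hw hz).trans (by omega)
    · intro hzT
      obtain ⟨t₀, ht1, ht2, rfl⟩ := hidx z hz hzi
      have hrt : r < t₀ := by
        rcases (hmin t₀ ht1 ht2 hz).lt_or_eq with h | h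
        · exact h
        · exact absurd (by rw [hj, h]) hzj
      set s := t₀ - r - 1 with hs
      have hzs : nxt f (f (i - t₀)) = f (j - s) := by
        rw [hS.nxt_apply]; congr 1; omega
      rw [hzs] at hzT
      rcases hT1 _ hzT with ⟨t, h1, h2, h3⟩ | ⟨t, h1, h2, -, h3⟩
      · have hst : s = t + 1 := by
          by_contra hne
          refine hS.ne_of_lt j (show s < N by omega) (show t + 1 < N by omega) hne ?_
          rw [h3]; congr 1; push_cast; ring
        -- A path from `f (i - t₀)` to `f i` through all vertices of the cycle but `f (j - s)`. It
        -- closes up through the distinct vertices `v` and `h`.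
        have hp := hS.isPathMap j
        have p1 : G.PathOn ((Icc (s + 1) (m - 1)).image fun τ : ℕ => f (j - τ))
            (f (j - (s + 1 : ℕ))) (f (j - (m - 1 : ℕ))) := hp.interval (by omega) (by omega)
        have p2 : G.PathOn ((Icc 0 t).image fun τ : ℕ => f (j - τ))
            (f (j - t)) (f (j - (0 : ℕ))) := (hp.interval (by omega) (by omega)).symm
        have p3 : G.PathOn ((Icc m (N - 1)).image fun τ : ℕ => f (j - τ))
            (f (j - (N - 1 : ℕ))) (f (j - m)) := (hp.interval (by omega) (by omega)).symm
        have p12 := hp.append p1 p2 (by simp; omega) (by simp; omega)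
          (by rw [Finset.disjoint_left]; simp; omega)
          (by rwa [show j - ((m - 1 : ℕ) : ℤ) = j - m + 1 by omega])
        have p123 := hp.append p12 p3 (by simp; omega) (by simp)
          (by rw [Finset.disjoint_left]; simp; omega) (by
            have h5 := hS.adj j
            rw [show f (j + 1) = f (j - ((N - 1 : ℕ) : ℤ)) from hS.eq_of_dvd ⟨1, by omega⟩] at h5
            simpa using h5)
        rw [show j - ((s + 1 : ℕ) : ℤ) = i - t₀ by omega, hfi] at p123
        have hcard := hS.card_add_one_lt _ _ _ v h hzi (mem_outNbrs.mp hz).2 (hS.notMem i) hv hh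
          hne.symm (mem_outNbrs.mp hz).1 hadj p123 (by
            rw [Finset.disjoint_left]
            intro u hu
            obtain ⟨τ, -, rfl⟩ := mem_image.mp hu
            exact hS.notMem _)
        rw [card_image_of_injOn (hp.inj.mono (by intro τ; simp; omega))] at hcard
        rw [card_union_of_disjoint (by rw [Finset.disjoint_left]; simp; omega),
          card_union_of_disjoint (by rw [Finset.disjoint_left]; simp; omega)] at hcard
        simp only [Nat.card_Icc] at hcard
        omega
      · have hst : s ≠ t - 1 := by omega
        refine hS.ne_of_lt j (show s < N by omega) (show t - 1 < N by omega) hst ?_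
        rw [h3]; congr 1; omega
    · rw [hfj1]
      exact hS.not_adj_nxt_nxt hjA (hA z hz)
    · rw [hfj1]
      exact hS.nxt_ne (hA z hz) hjA hzj
    · obtain ⟨k, rfl⟩ := hS.exists_of_attach (hA z hz)
      exact ⟨k + 1, (hS.nxt_apply k).symm⟩)
  omega

end IsStuck

end Local

/-! ### Graphs in which every vertex has a vertex at distance four -/

section Branching

variable {V : Type*} [Fintype V] [DecidableEq V] {G : SimpleGraph V} [DecidableRel G.Adj]
  {H : Finset V} {N : ℕ} {f : ℤ → V}

namespace IsStuck

/-- If `v ∈ H` has at least two neighbours outside `H`, then every neighbour of `v` in `H` has at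
least three neighbours outside `H`. -/
theorem three_le_card_outNbrs_of_adj (hS : G.IsStuck H N f) (hT : G.TripleCondition)
    (hG : G.Connected) {v h : V} (hv : v ∈ H) (hk : 2 ≤ (G.outNbrs H v).card) (hh : h ∈ H)
    (hvh : G.Adj v h) : 3 ≤ (G.outNbrs H h).card := by
  by_contra hkh
  have hA : ∀ w ∈ G.outNbrs H v, G.Attach H w := fun w hw => attach_of_mem_outNbrs hv hw
  have hdh : ∀ w ∈ G.outNbrs H v, G.dist w h ≤ 2 := fun w hw =>
    hG.dist_le_add (mem_outNbrs.mp hw).1.symm.dist_le_one hvh.dist_le_one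
  -- otherwise the successors of `w` and `u` are both close to `w`, and so is `h`
  have hnoA : ∀ w ∈ G.outNbrs H v, ∀ u, G.Adj w u → ¬ G.Attach H u := by
    intro w hw u hwu hu
    exact hkh (hS.three_le_card_outNbrs hT hG (hA w hw) hu hwu.ne (c := w) hh (hdh w hw)
      (hS.adj_nxt (hA w hw)).dist_le_one
      (hG.dist_le_add hwu.dist_le_one (hS.adj_nxt hu).dist_le_one))
  have hnH : ∀ w ∈ G.outNbrs H v, ∀ u ∈ H, u ≠ v → ¬ G.Adj u w := fun w hw u hu huv =>
    hS.not_adj_of_mem_outNbrs hT hG hv hk hw hu huv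
  obtain ⟨w, hw, w', hw', hne⟩ := one_lt_card.mp hk
  -- the neighbourhoods of `h`, `w` and `w'` pairwise meet only in `v`
  have h1 : ∀ w ∈ G.outNbrs H v,
      (G.neighborFinset h ∩ G.neighborFinset w).card ≤ 1 := by
    intro w hw
    refine (card_le_card (t := {v}) fun u hu => ?_).trans (by simp)
    simp only [mem_inter, mem_neighborFinset] at hu
    rw [mem_singleton]
    by_contra huv
    by_cases huH : u ∈ H
    · exact hnH w hw u huH huv hu.2.symm
    · exact hnoA w hw u hu.2 ⟨huH, h, hh, hu.1⟩
  have h2 : (G.neighborFinset w ∩ G.neighborFinset w').card ≤ 1 := by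
    refine (card_le_card (t := {v}) fun u hu => ?_).trans (by simp)
    simp only [mem_inter, mem_neighborFinset] at hu
    rw [mem_singleton]
    by_contra huv
    have huH : u ∉ H := fun huH => hnH w hw u huH huv hu.1.symm
    exact hS.false_of_two_reroutes hT hG (hA w hw) (hA w' hw') hne huH (hnoA w hw u hu.1) hu.2
      (c := w) hh (by omega) (hdh w hw) (hS.adj_nxt (hA w hw)).dist_le_one
      (hu.1.dist_le_one.trans (by omega)) hh (by omega) (hdh w' hw') (hnoA w' hw')
  have hhw : ∀ w ∈ G.outNbrs H v, h ≠ w := fun w hw h' => (hA w hw).1 (h' ▸ hh)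
  have hhw' : ∀ w ∈ G.outNbrs H v, ¬ G.Adj h w := fun w hw => hnH w hw h hh hvh.ne'
  have hww' : ¬ G.Adj w w' := fun h => hnoA w hw w' h (hA w' hw')
  have := hT.card_add_two_le hG (c := v) (a := h) (b := w) (d := w')
    (hvh.dist_le_one.trans (by omega)) ((mem_outNbrs.mp hw).1.dist_le_one.trans (by omega))
    ((mem_outNbrs.mp hw').1.dist_le_one.trans (by omega)) (hhw w hw) (hhw w' hw') hne
    (hhw' w hw) (hhw' w' hw') hww' (R := {h, w, w'}) (by
      intro u hu
      simp only [mem_insert, mem_singleton] at hu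
      rcases hu with rfl | rfl | rfl
      · exact ⟨hvh.dist_le_one.trans (by omega), by simp, fun h => hhw' _ hw h.symm,
          fun h => hhw' _ hw' h.symm⟩
      · exact ⟨(mem_outNbrs.mp hw).1.dist_le_one.trans (by omega), hhw' _ hw, by simp,
          fun h => hww' h.symm⟩
      · exact ⟨(mem_outNbrs.mp hw').1.dist_le_one.trans (by omega), hhw' _ hw', hww', by simp⟩)
  rw [card_eq_three.mpr ⟨h, w, w', hhw w hw, hhw w' hw', hne, rfl⟩] at this
  have := h1 w hw
  have := h1 w' hw'
  omega

omit [Fintype V] [DecidableRel G.Adj] in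
lemma card_insert_image_nxt (hS : G.IsStuck H N f) {v : V} (hv : v ∈ H) {A : Finset V}
    (hA : ∀ w ∈ A, G.Attach H w) : (insert v (A.image (nxt f))).card = A.card + 1 := by
  rw [card_insert_of_notMem (fun h => by
    obtain ⟨z, hz, h⟩ := mem_image.mp h
    exact hS.ne_nxt hv (hA z hz) h.symm), hS.image_nxt_card hA]

/-- The degree condition for the triple `v`, `nxt f w`, `c` with `v ∈ H` and `c` far away from
`nxt f w`. -/
lemma card_add_three_le_inter (hS : G.IsStuck H N f) (hT : G.TripleCondition)
    (hG : G.Connected) {v w p c : V} (hv : v ∈ H) (hw : G.Attach H w) (hpv : G.dist p v ≤ 2)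
    (hpx : G.dist p (nxt f w) ≤ 2) (hpc : G.dist p c ≤ 2) (hvc : 2 ≤ G.dist v c)
    (hxc : 3 ≤ G.dist (nxt f w) c) {A : Finset V}
    (hA : ∀ z ∈ A, G.Attach H z ∧ G.dist p (nxt f z) ≤ 3 ∧ ¬ G.Adj c (nxt f z)) :
    A.card + 3 ≤ (G.neighborFinset v ∩ G.neighborFinset (nxt f w)).card +
      (G.neighborFinset v ∩ G.neighborFinset c).card := by
  have h := hT.card_add_two_le hG (c := p) (a := v) (b := nxt f w) (d := c) hpv hpx hpc
    (hS.ne_nxt hv hw) (ne_of_one_le_dist (show 1 ≤ G.dist v c by omega))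
    (ne_of_one_le_dist (show 1 ≤ G.dist (nxt f w) c by omega)) (hS.not_adj_nxt hw v hv)
    (not_adj_of_two_le_dist hvc) (not_adj_of_two_le_dist (by omega))
    (R := insert v (A.image (nxt f))) (by
      intro u hu
      rcases mem_insert.mp hu with rfl | hu
      · exact ⟨by omega, by simp, fun h => hS.not_adj_nxt hw u hv h.symm,
          fun h => not_adj_of_two_le_dist hvc h.symm⟩
      · obtain ⟨z, hz, rfl⟩ := mem_image.mp hu
        obtain ⟨h1, h2, h3⟩ := hA z hz
        exact ⟨h2, hS.not_adj_nxt h1 v hv, hS.not_adj_nxt_nxt hw h1, h3⟩)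
  rw [hS.card_insert_image_nxt hv fun z hz => (hA z hz).1,
    inter_eq_empty_of_three_le_dist hG hxc, card_empty] at h
  omega

/-- The same as `card_add_three_le_inter` when `c` is also far away from `v`. -/
lemma card_add_three_le_inter' (hS : G.IsStuck H N f) (hT : G.TripleCondition)
    (hG : G.Connected) {v w p c : V} (hv : v ∈ H) (hw : G.Attach H w) (hpv : G.dist p v ≤ 2)
    (hpx : G.dist p (nxt f w) ≤ 2) (hpc : G.dist p c ≤ 2) (hvc : 3 ≤ G.dist v c)
    (hxc : 3 ≤ G.dist (nxt f w) c) {A : Finset V}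
    (hA : ∀ z ∈ A, G.Attach H z ∧ G.dist p (nxt f z) ≤ 3 ∧ ¬ G.Adj c (nxt f z)) :
    A.card + 3 ≤ (G.neighborFinset v ∩ G.neighborFinset (nxt f w)).card := by
  have h := hS.card_add_three_le_inter hT hG hv hw hpv hpx hpc (by omega) hxc hA
  rwa [inter_eq_empty_of_three_le_dist hG hvc, card_empty, add_zero] at h

/-- A vertex outside `H` has at most one neighbour in `H` adjacent to `v`. -/
lemma card_inter_inter_le_one (hS : G.IsStuck H N f) (hT : G.TripleCondition)
    (hG : G.Connected) {v c : V} (hv : v ∈ H) (hk : 2 ≤ (G.outNbrs H v).card) (hc : c ∉ H) :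
    ((G.neighborFinset v ∩ H) ∩ G.neighborFinset c).card ≤ 1 := by
  refine card_le_one.mpr fun a ha b hb => ?_
  simp only [mem_inter, mem_neighborFinset] at ha hb
  by_contra hab
  have := hS.three_le_card_outNbrs_of_adj hT hG hv hk ha.1.2 ha.1.1
  exact hS.not_adj_of_mem_outNbrs hT hG ha.1.2 (by omega) (mem_outNbrs.mpr ⟨ha.2.symm, hc⟩)
    hb.1.2 (Ne.symm hab) hb.2.symm

lemma card_inter_le (H : Finset V) (v c : V) : (G.neighborFinset v ∩ G.neighborFinset c).card ≤
    (G.outNbrs H v ∩ G.neighborFinset c).card +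
      ((G.neighborFinset v ∩ H) ∩ G.neighborFinset c).card := by
  refine le_trans (card_le_card ?_) (card_union_le _ _)
  intro u hu
  simp only [mem_inter, mem_union, mem_outNbrs, mem_neighborFinset] at hu ⊢
  tauto

/-- A vertex `c` at distance two from `v` that is not adjacent to any successor of a neighbour of
`v` is at distance at most two from all these successors. -/
theorem dist_nxt_le_two_of_not_adj (hS : G.IsStuck H N f) (hT : G.TripleCondition)
    (hG : G.Connected) {v w c : V} (hv : v ∈ H) (hk : 2 ≤ (G.outNbrs H v).card)
    (hw : w ∈ G.outNbrs H v) (hvc : G.dist v c = 2)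
    (hX : ∀ z ∈ G.outNbrs H v, ¬ G.Adj c (nxt f z)) : G.dist (nxt f w) c ≤ 2 := by
  by_contra hd
  have hA : ∀ u ∈ G.outNbrs H v, G.Attach H u := fun u hu => attach_of_mem_outNbrs hv hu
  obtain ⟨O, hO⟩ : ∃ O, O = (G.neighborFinset v ∩ H) ∩ G.neighborFinset c := ⟨_, rfl⟩
  -- Enough attached vertices whose successors lie in the ball around `v`: the neighbours of `v`
  -- and, if `c ∈ H`, one neighbour outside `H` of each common neighbour of `v` and `c` in `H`.
  obtain ⟨A, hAA, hAc⟩ : ∃ A : Finset V, (∀ z ∈ A, G.Attach H z ∧ G.dist v (nxt f z) ≤ 3 ∧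
      ¬ G.Adj c (nxt f z)) ∧ (G.outNbrs H v).card + O.card ≤ A.card + 1 := by
    by_cases hc : c ∈ H
    · have hO3 : ∀ h ∈ O, h ∈ H ∧ G.Adj v h ∧ 3 ≤ (G.outNbrs H h).card := by
        intro h hh
        simp only [hO, mem_inter, mem_neighborFinset] at hh
        exact ⟨hh.1.2, hh.1.1, hS.three_le_card_outNbrs_of_adj hT hG hv hk hh.1.2 hh.1.1⟩
      have hex : ∀ h, ∃ z, h ∈ O → z ∈ G.outNbrs H h := by
        intro h
        by_cases hh : h ∈ O
        · have := (hO3 h hh).2.2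
          obtain ⟨z, hz⟩ := card_pos.mp (show 0 < (G.outNbrs H h).card by omega)
          exact ⟨z, fun _ => hz⟩
        · exact ⟨h, fun h' => absurd h' hh⟩
      choose g hg using hex
      have hginj : Set.InjOn g O := by
        intro a ha b hb hab
        by_contra hne
        have h1 := hg b hb
        rw [← hab] at h1
        exact hS.not_adj_of_mem_outNbrs hT hG (hO3 a ha).1 (by have := (hO3 a ha).2.2; omega)
          (hg a ha) (hO3 b hb).1 (Ne.symm hne) (mem_outNbrs.mp h1).1
      have hdisj : Disjoint (G.outNbrs H v) (O.image g) := by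
        rw [Finset.disjoint_right]
        intro u hu hu'
        obtain ⟨h, hh, rfl⟩ := mem_image.mp hu
        exact hS.not_adj_of_mem_outNbrs hT hG hv hk hu' (hO3 h hh).1 (hO3 h hh).2.1.ne'
          (mem_outNbrs.mp (hg h hh)).1
      refine ⟨G.outNbrs H v ∪ O.image g, ?_, ?_⟩
      · intro z hz
        rcases mem_union.mp hz with hz | hz
        · exact ⟨hA z hz, (hS.dist_nxt_le_two hG hv hz).trans (by omega), hX z hz⟩
        · obtain ⟨h, hh, rfl⟩ := mem_image.mp hz
          obtain ⟨h1, h2, -⟩ := hO3 h hh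
          have hgA := attach_of_mem_outNbrs h1 (hg h hh)
          exact ⟨hgA, hG.dist_le_add h2.dist_le_one (hS.dist_nxt_le_two hG h1 (hg h hh)),
            hS.not_adj_nxt hgA c hc⟩
      · rw [card_union_of_disjoint hdisj, card_image_of_injOn hginj]
        omega
    · exact ⟨G.outNbrs H v, fun z hz => ⟨hA z hz, (hS.dist_nxt_le_two hG hv hz).trans (by omega),
        hX z hz⟩, by have := hS.card_inter_inter_le_one hT hG hv hk hc; rw [hO]; omega⟩
  have h := hS.card_add_three_le_inter hT hG hv (hA w hw) (p := v) (c := c) (by simp)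
    (hS.dist_nxt_le_two hG hv hw) hvc.le hvc.ge (by omega) hAA
  have h1 := card_inter_le (G := G) H v c
  rw [← hO] at h1
  have h2 : Disjoint (G.neighborFinset v ∩ G.neighborFinset (nxt f w))
      (G.outNbrs H v ∩ G.neighborFinset c) := by
    have h1 := inter_eq_empty_of_three_le_dist hG (show 3 ≤ G.dist (nxt f w) c by omega)
    rw [← disjoint_iff_inter_eq_empty] at h1
    exact h1.mono inter_subset_right inter_subset_right
  have h3 := card_le_card (union_subset (inter_subset_outNbrs (v := v) (hS.not_adj_nxt (hA w hw)))
    (inter_subset_left : G.outNbrs H v ∩ G.neighborFinset c ⊆ G.outNbrs H v))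
  rw [card_union_of_disjoint h2] at h3
  omega

/-- The successors of the neighbours of `v` are within distance two of every vertex at distance
four from `v`. -/
theorem dist_nxt_le_two_of_dist_eq_four (hS : G.IsStuck H N f) (hT : G.TripleCondition)
    (hG : G.Connected) {v w z : V} (hv : v ∈ H) (hk : 2 ≤ (G.outNbrs H v).card)
    (hw : w ∈ G.outNbrs H v) (hvz : G.dist v z = 4) : G.dist (nxt f w) z ≤ 2 := by
  by_contra hd
  have hA : ∀ u ∈ G.outNbrs H v, G.Attach H u := fun u hu => attach_of_mem_outNbrs hv hu
  have hfar : ∀ u ∈ G.outNbrs H v, ¬ G.Adj z (nxt f u) := by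
    intro u hu h
    have := hG.dist_le_add (hS.dist_nxt_le_two hG hv hu) h.symm.dist_le_one
    omega
  -- no vertex `c` in between is close to all the successors
  have hnoc : ∀ c, G.dist c v ≤ 2 → G.dist c z ≤ 2 → G.dist c (nxt f w) ≤ 2 →
      ¬ ∀ u ∈ G.outNbrs H v, G.dist c (nxt f u) ≤ 3 := by
    intro c hcv hcz hcx hcX
    have h := hS.card_add_three_le_inter' hT hG hv (hA w hw) (p := c) (c := z) hcv hcx hcz
      (by omega) (by omega) (A := G.outNbrs H v) fun u hu => ⟨hA u hu, hcX u hu, hfar u hu⟩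
    have := card_le_card (inter_subset_outNbrs (v := v) (hS.not_adj_nxt (hA w hw)))
    omega
  by_cases hex : ∃ u ∈ G.outNbrs H v, G.dist (nxt f u) z ≤ 2
  · obtain ⟨u, hu, huz⟩ := hex
    refine hnoc (nxt f u) ?_ huz (hS.dist_nxt_nxt_le_two hT hG hv hu hw) fun t ht =>
      (hS.dist_nxt_nxt_le_two hT hG hv hu ht).trans (by omega)
    rw [dist_comm]
    exact hS.dist_nxt_le_two hG hv hu
  push Not at hex
  obtain ⟨c, hvc, hcz⟩ := hG.exists_dist_eq_of_dist_eq_add (i := 2) (j := 2) hvz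
  have hcv : G.dist c v ≤ 2 := by rw [dist_comm]; omega
  -- a successor adjacent to `c` would violate the degree condition with `v` and `z`
  have hcX : ∀ u ∈ G.outNbrs H v, ¬ G.Adj c (nxt f u) := by
    intro u hu hcu
    have h := hS.card_add_three_le_inter' hT hG hv (hA u hu) (p := c) (c := z) hcv
      (hcu.dist_le_one.trans (by omega)) hcz.le (by omega) (by have := hex u hu; omega)
      (A := G.neighborFinset v ∩ G.neighborFinset (nxt f u)) (by
        intro t ht
        have ht' := inter_subset_outNbrs (hS.not_adj_nxt (hA u hu)) ht
        simp only [mem_inter, mem_neighborFinset] at ht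
        exact ⟨hA t ht', hG.dist_le_add (hG.dist_le_add hcu.dist_le_one ht.2.dist_le_one)
          (hS.adj_nxt (hA t ht')).dist_le_one, hfar t ht'⟩)
    omega
  have hcd : ∀ u ∈ G.outNbrs H v, G.dist c (nxt f u) ≤ 2 := fun u hu => by
    rw [dist_comm]
    exact hS.dist_nxt_le_two_of_not_adj hT hG hv hk hu hvc hcX
  exact hnoc c hcv hcz.le (hcd w hw) fun u hu => (hcd u hu).trans (by omega)

/-- A vertex at distance four from the successor of a neighbour of `v` is at distance six
from `v`. -/
theorem dist_eq_six (hS : G.IsStuck H N f) (hT : G.TripleCondition)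
    (hG : G.Connected) {v w y : V} (hv : v ∈ H) (hk : 2 ≤ (G.outNbrs H v).card)
    (hw : w ∈ G.outNbrs H v) (hxy : G.dist (nxt f w) y = 4) : G.dist v y = 6 := by
  have hA : ∀ u ∈ G.outNbrs H v, G.Attach H u := fun u hu => attach_of_mem_outNbrs hv hu
  have hvx := hS.dist_nxt_le_two hG hv hw
  have hxv : G.dist (nxt f w) v ≤ 2 := by rwa [dist_comm]
  have h2 := hG.dist_le_add hxv (le_refl (G.dist v y))
  have h6 := hG.dist_le_add hvx hxy.le
  have hnadj : ∀ u ∈ G.outNbrs H v, ¬ G.Adj y (nxt f u) := by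
    intro u hu h
    have := hG.dist_le_add (hS.dist_nxt_nxt_le_two hT hG hv hw hu) h.symm.dist_le_one
    omega
  rcases Nat.lt_or_ge (G.dist v y) 5 with h5 | h5
  · exfalso
    obtain h | h | h : G.dist v y = 2 ∨ G.dist v y = 3 ∨ G.dist v y = 4 := by omega
    · have := hS.dist_nxt_le_two_of_not_adj hT hG hv hk hw h hnadj
      omega
    · obtain ⟨c, hvc, hcy⟩ := hG.exists_dist_eq_of_dist_eq_add (i := 2) (j := 1) h
      by_cases hX : ∀ u ∈ G.outNbrs H v, ¬ G.Adj c (nxt f u)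
      · have h1 := hS.dist_nxt_le_two_of_not_adj hT hG hv hk hw hvc hX
        have := hG.dist_le_add h1 hcy.le
        omega
      · push Not at hX
        obtain ⟨u, hu, hcu⟩ := hX
        have h := hS.card_add_three_le_inter' hT hG hv (hA w hw) (p := nxt f u) (c := y)
          (by rw [dist_comm]; exact hS.dist_nxt_le_two hG hv hu)
          (hS.dist_nxt_nxt_le_two hT hG hv hu hw)
          (hG.dist_le_add hcu.symm.dist_le_one hcy.le) (by omega) (by omega)
          (A := G.outNbrs H v) fun t ht => ⟨hA t ht,
            (hS.dist_nxt_nxt_le_two hT hG hv hu ht).trans (by omega), hnadj t ht⟩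
        have := card_le_card (inter_subset_outNbrs (v := v) (hS.not_adj_nxt (hA w hw)))
        omega
    · have := hS.dist_nxt_le_two_of_dist_eq_four hT hG hv hk hw h
      omega
  · obtain ⟨z, hvz, hzy⟩ := hG.exists_dist_eq_of_dist_eq_add (i := 4) (j := G.dist v y - 4)
      (show G.dist v y = 4 + (G.dist v y - 4) by omega)
    have h1 := hS.dist_nxt_le_two_of_dist_eq_four hT hG hv hk hw hvz
    have := hG.dist_le_add h1 hzy.le
    omega

/-- A cycle that cannot be enlarged through a set `H` attached to it does not exist if every
vertex has a vertex at distance four. The contradiction comes from the triple consisting of the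
successors of two neighbours of some `v ∈ H` and a vertex `y₀` at distance six from `v`, in the
ball around a vertex `z` at distance four from `v` and two from `y₀`. -/
theorem false_of_forall_exists_dist_eq_four (hS : G.IsStuck H N f) (hT : G.TripleCondition)
    (hG : G.Connected) (hP : G.PuncturedBallsConnected) (h4 : ∀ u, ∃ y, G.dist u y = 4)
    (hne : ∃ w, G.Attach H w) : False := by
  obtain ⟨w₀, hw₀⟩ := hne
  obtain ⟨v, hv, hk⟩ := hS.exists_two_le_card_outNbrs hT hG hP hw₀
  have hA : ∀ u ∈ G.outNbrs H v, G.Attach H u := fun u hu => attach_of_mem_outNbrs hv hu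
  obtain ⟨w, hw, w', hw', hww'⟩ := one_lt_card.mp hk
  obtain ⟨y₀, hy₀⟩ := h4 (nxt f w)
  have hvy := hS.dist_eq_six hT hG hv hk hw hy₀
  obtain ⟨z, hvz, hzy⟩ := hG.exists_dist_eq_of_dist_eq_add (i := 4) (j := 2) hvy
  have hXz : ∀ u ∈ G.outNbrs H v, G.dist z (nxt f u) ≤ 2 := fun u hu => by
    rw [dist_comm]
    exact hS.dist_nxt_le_two_of_dist_eq_four hT hG hv hk hu hvz
  have hXy : ∀ u ∈ G.outNbrs H v, 4 ≤ G.dist (nxt f u) y₀ := fun u hu => by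
    have := hG.dist_le_add (hS.dist_nxt_le_two hG hv hu) (le_refl (G.dist (nxt f u) y₀))
    omega
  have hNy : ∀ u ∈ G.outNbrs H v, ∀ t, G.dist (nxt f u) t ≤ 2 → ¬ G.Adj y₀ t := by
    intro u hu t ht h
    have := hG.dist_le_add ht h.symm.dist_le_one
    have := hXy u hu
    omega
  obtain ⟨j, m, hm1, hmN, hj, hjm⟩ := hS.exists_index (hA w hw) (hA w' hw') hww'
  obtain ⟨h1, T, hT1, hT2⟩ := hS.crossing hm1 hmN (hj ▸ hA w' hw') (hjm ▸ hA w hw)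
  rw [← hS.nxt_apply, ← hS.nxt_apply, hj, hjm] at h1 hT2
  simp only [← hS.nxt_apply (j - m), hjm] at hT1
  -- the shifted neighbours of `nxt f w` stay in the ball around `z` and away from `y₀`, so that
  -- `y₀` contributes its whole degree to the saving in the crossing lemma
  have hTd : ∀ y ∈ T, y ∉ H ∧ G.dist (nxt f w) y ≤ 2 := by
    intro y hy
    rcases hT1 y hy with ⟨t, -, hadj, rfl⟩ | ⟨t, -, -, hadj, rfl⟩
    · have h := hS.adj (j - t - 1)
      rw [sub_add_cancel] at h
      exact ⟨hS.notMem _, hG.dist_le_add hadj.dist_le_one h.symm.dist_le_one⟩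
    · exact ⟨hS.notMem _, hG.dist_le_add hadj.dist_le_one (hS.adj _).dist_le_one⟩
  have hTz : ∀ y ∈ T, G.dist z y ≤ 3 := by
    intro y hy
    obtain ⟨hyH, hxy⟩ := hTd y hy
    by_contra hzy
    have hyz : 4 ≤ G.dist y z := by rw [dist_comm]; omega
    have hvy0 : v ≠ y := fun h => hyH (h ▸ hv)
    have hvy1 : ¬ G.Adj v y := by
      intro h
      have hy' : y ∈ G.outNbrs H v := mem_outNbrs.mpr ⟨h, hyH⟩
      have := hG.dist_le_add (hXz y hy') (hS.adj_nxt (hA y hy')).symm.dist_le_one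
      omega
    have hvy2 := hG.two_le_dist hvy0 hvy1
    have h := hT.card_add_two_le hG (c := nxt f w) (a := v) (b := y) (d := z)
      (by rw [dist_comm]; exact hS.dist_nxt_le_two hG hv hw) hxy
      (by rw [dist_comm]; exact hXz w hw) hvy0 (ne_of_one_le_dist (show 1 ≤ G.dist v z by omega))
      (ne_of_one_le_dist (show 1 ≤ G.dist y z by omega)) hvy1
      (not_adj_of_two_le_dist (by omega)) (not_adj_of_two_le_dist (by omega))
      (R := insert v ((G.outNbrs H v).image (nxt f))) (by
        intro u hu
        rcases mem_insert.mp hu with rfl | hu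
        · refine ⟨?_, by simp, fun h => hvy1 h.symm, fun h => ?_⟩
          · rw [dist_comm]; exact (hS.dist_nxt_le_two hG hv hw).trans (by omega)
          · have := h.symm.dist_le_one
            omega
        · obtain ⟨t, ht, rfl⟩ := mem_image.mp hu
          refine ⟨(hS.dist_nxt_nxt_le_two hT hG hv hw ht).trans (by omega),
            hS.not_adj_nxt (hA t ht) v hv, fun h => ?_, fun h => ?_⟩
          · have := hG.dist_le_add (hXz t ht) h.symm.dist_le_one
            omega
          · have := hG.dist_le_add (hS.dist_nxt_le_two hG hv ht) h.symm.dist_le_one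
            omega)
    rw [hS.card_insert_image_nxt hv hA, inter_eq_empty_of_three_le_dist hG (show 3 ≤ G.dist v z by
      omega), inter_eq_empty_of_three_le_dist hG (show 3 ≤ G.dist y z by omega), card_empty] at h
    have h3 := card_inter_le (G := G) H v y
    have h5 := hS.card_inter_inter_le_one hT hG hv hk hyH
    have h6 := card_le_card
      (inter_subset_left : G.outNbrs H v ∩ G.neighborFinset y ⊆ G.outNbrs H v)
    omega
  have hsub : ∀ u ∈ G.outNbrs H v,
      G.neighborFinset (nxt f u) ⊆ G.ballThree z \ G.neighborFinset y₀ := by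
    intro u hu t ht
    refine mem_sdiff.mpr ⟨hG.neighborFinset_subset_ballThree (hXz u hu) ht, ?_⟩
    rw [mem_neighborFinset] at ht ⊢
    exact hNy u hu t (ht.dist_le_one.trans (by omega))
  have h2 := hT2 (G.ballThree z \ G.neighborFinset y₀) ∅ (hsub w hw) (hsub w' hw')
    (fun y hy => mem_sdiff.mpr ⟨mem_ballThree.mpr (hTz y hy), by
      rw [mem_neighborFinset]
      exact hNy w hw y (hTd y hy).2⟩)
    (mem_sdiff.mpr ⟨mem_ballThree.mpr ((hXz w' hw').trans (by omega)), by
      rw [mem_neighborFinset]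
      exact hNy w' hw' _ (by simp)⟩) (by simp) (by simp)
  have h3 := card_sdiff_add_card_eq_card (hG.neighborFinset_subset_ballThree hzy.le)
  rw [card_neighborFinset_eq_degree] at h3
  have h5 := hT z (nxt f w) (nxt f w') y₀ (hXz w hw) (hXz w' hw') hzy.le
    (hS.nxt_ne (hA w hw) (hA w' hw') hww')
    (ne_of_one_le_dist (show 1 ≤ G.dist (nxt f w) y₀ by have := hXy w hw; omega))
    (ne_of_one_le_dist (show 1 ≤ G.dist (nxt f w') y₀ by have := hXy w' hw'; omega)) h1
    (not_adj_of_two_le_dist (by have := hXy w hw; omega))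
    (not_adj_of_two_le_dist (by have := hXy w' hw'; omega))
  simp at h2
  omega

end IsStuck

end Branching

/-! ### Graphs with a separation compatible with the degree condition -/

section Cut

variable {V : Type*} [Fintype V] [DecidableEq V] {G : SimpleGraph V} [DecidableRel G.Adj]
  {H : Finset V} {N : ℕ} {f : ℤ → V}

/-- The vertex set is split into `A`, `B` and `S`, and no edge joins `A` to `B`. -/
structure IsSeparation (G : SimpleGraph V) (A B S : Finset V) : Prop where
  mem : ∀ u, u ∈ A ∨ u ∈ B ∨ u ∈ S
  disjoint : Disjoint A B
  disjoint_left : Disjoint A S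
  disjoint_right : Disjoint B S
  not_adj : ∀ a ∈ A, ∀ b ∈ B, ¬ G.Adj a b

namespace IsSeparation

variable {A B S : Finset V}

omit [Fintype V] [DecidableEq V] [DecidableRel G.Adj] in
lemma symm (h : G.IsSeparation A B S) : G.IsSeparation B A S where
  mem u := by have := h.mem u; tauto
  disjoint := h.disjoint.symm
  disjoint_left := h.disjoint_right
  disjoint_right := h.disjoint_left
  not_adj b hb a ha hba := h.not_adj a ha b hb hba.symm

omit [DecidableRel G.Adj] in
lemma card_sdiff_add (h : G.IsSeparation A B S) (Z : Finset V) :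
    (A \ Z).card + (B \ Z).card + (S \ Z).card + Z.card = Fintype.card V := by
  rw [← card_union_of_disjoint (h.disjoint.mono sdiff_subset sdiff_subset),
    ← card_union_of_disjoint, ← card_union_of_disjoint, ← card_univ]
  · congr 1
    ext u
    have := h.mem u
    simp only [mem_union, mem_sdiff, mem_univ, iff_true]
    tauto
  · rw [Finset.disjoint_left]
    intro u hu
    simp only [mem_union, mem_sdiff] at hu
    tauto
  · rw [Finset.disjoint_union_left]
    exact ⟨h.disjoint_left.mono sdiff_subset sdiff_subset,
      h.disjoint_right.mono sdiff_subset sdiff_subset⟩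

omit [Fintype V] [DecidableEq V] [DecidableRel G.Adj] in
lemma mem_of_adj (h : G.IsSeparation A B S) {a u : V} (ha : a ∈ A) (hu : G.Adj a u) :
    u ∈ A ∨ u ∈ S := by
  rcases h.mem u with h1 | h1 | h1
  · exact Or.inl h1
  · exact absurd hu (h.not_adj a ha u h1)
  · exact Or.inr h1

omit [Fintype V] [DecidableEq V] [DecidableRel G.Adj] in
lemma ne (h : G.IsSeparation A B S) {a b : V} (ha : a ∈ A) (hb : b ∈ B) : a ≠ b :=
  fun hab => Finset.disjoint_left.mp h.disjoint ha (hab ▸ hb)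

lemma degree_add_one_le (h : G.IsSeparation A B S) {b : V} (hb : b ∈ B) :
    G.degree b + 1 ≤ B.card + S.card := by
  have h1 : G.neighborFinset b ⊆ B.erase b ∪ S := by
    intro u hu
    rw [mem_neighborFinset] at hu
    rcases h.symm.mem_of_adj hb hu with h2 | h2
    · exact mem_union_left _ (mem_erase.mpr ⟨hu.ne', h2⟩)
    · exact mem_union_right _ h2
  have h2 := (card_le_card h1).trans (card_union_le _ _)
  rw [card_neighborFinset_eq_degree] at h2
  have := card_erase_add_one hb
  omega

end IsSeparation

namespace IsStuck

variable {A B S W : Finset V}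

lemma degree_add_one_le_card_add {h : V} {Y : Finset V} (hh : h ∈ H)
    (hW : ∀ w, w ∈ W ↔ G.Attach H w) (hY : ∀ u ∈ H, G.Adj h u → u ∈ Y) (hhY : h ∈ Y) :
    G.degree h + 1 ≤ Y.card + W.card := by
  have h1 : G.neighborFinset h ⊆ Y.erase h ∪ W := by
    intro u hu
    rw [mem_neighborFinset] at hu
    by_cases huH : u ∈ H
    · exact mem_union_left _ (mem_erase.mpr ⟨hu.ne', hY u huH hu⟩)
    · exact mem_union_right _ ((hW u).mpr ⟨huH, h, hh, hu⟩)
  have h2 := (card_le_card h1).trans (card_union_le _ _)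
  rw [card_neighborFinset_eq_degree] at h2
  have := card_erase_add_one hhY
  omega

/-- The contradiction for a separation `(A, B)` of `G` with a successor of an attached vertex in
`A`. Successively, no successor lies in `B`, the set `H` does not meet `A`, and `B` consists of
vertices in or attached to `H`; this leaves the crossing lemma for two successors in `A`, or the
situation where all of `S` consists of successors. -/
theorem false_of_nxt_mem_left (hS : G.IsStuck H N f)
    (hdeg : ∀ a b d : V, a ≠ b → a ≠ d → b ≠ d → ¬ G.Adj a b → ¬ G.Adj a d → ¬ G.Adj b d →
      Fintype.card V + S.card ≤ G.degree a + G.degree b + G.degree d)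
    (hsep : G.IsSeparation A B S) (hB : B.Nonempty) (hH : H.Nonempty)
    (hW : ∀ w, w ∈ W ↔ G.Attach H w) (hWS : S.card < W.card) {w : V} (hw : w ∈ W)
    (hwA : nxt f w ∈ A) : False := by
  -- `X` is the set of all successors of attached vertices
  obtain ⟨X, hX⟩ : ∃ X, X = W.image (nxt f) := ⟨_, rfl⟩
  have hXc : X.card = W.card := by rw [hX, hS.image_nxt_card fun w hw => (hW w).mp hw]
  have hXmem : ∀ x ∈ X, ∃ w, G.Attach H w ∧ nxt f w = x := by
    intro x hx
    obtain ⟨w, hw, rfl⟩ := mem_image.mp (hX ▸ hx)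
    exact ⟨w, (hW w).mp hw, rfl⟩
  have hwAtt := (hW w).mp hw
  obtain ⟨a, ha⟩ : ∃ a, a = nxt f w := ⟨_, rfl⟩
  have haX : a ∈ X := by rw [ha, hX]; exact mem_image_of_mem _ hw
  have hXX : ∀ x ∈ X, ∀ y ∈ X, ¬ G.Adj x y := by
    intro x hx y hy
    obtain ⟨u, hu, rfl⟩ := hXmem x hx
    obtain ⟨v, hv, rfl⟩ := hXmem y hy
    exact hS.not_adj_nxt_nxt hu hv
  have hXH : ∀ x ∈ X, x ∉ H ∧ x ∉ W ∧ ∀ h ∈ H, ¬ G.Adj h x := by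
    intro x hx
    obtain ⟨u, hu, rfl⟩ := hXmem x hx
    exact ⟨hS.nxt_notMem hu, fun h => hS.not_attach_nxt hu ((hW _).mp h), hS.not_adj_nxt hu⟩
  rw [← ha] at hwA
  obtain ⟨Z, hZ⟩ : ∃ Z, Z = H ∪ X := ⟨_, rfl⟩
  have hZc : Z.card = H.card + X.card := by
    rw [hZ, card_union_of_disjoint]
    exact Finset.disjoint_right.mpr fun x hx => (hXH x hx).1
  have hpart := hsep.card_sdiff_add Z
  have hda : G.degree a ≤ (A \ Z).card + (S \ Z).card := by
    rw [← card_neighborFinset_eq_degree]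
    refine le_trans (card_le_card fun u hu => ?_) (card_union_le _ _)
    rw [mem_neighborFinset] at hu
    have huZ : u ∉ Z := by
      rw [hZ, mem_union]
      rintro (h | h)
      · exact (hXH a haX).2.2 u h hu.symm
      · exact hXX a haX u h hu
    simp only [mem_union, mem_sdiff]
    have := hsep.mem_of_adj hwA hu
    tauto
  have hah : ∀ h ∈ H, h ≠ a := fun h hh h' => (hXH a haX).1 (h' ▸ hh)
  -- a vertex `b` of `B` away from `H` forms a triple with `a` and any vertex of `H`
  have key : ∀ b ∈ B, b ∉ H → b ∉ W → ¬ ∀ u ∈ B, G.Adj b u → u ∉ X := by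
    intro b hb hbH hbW hbX
    obtain ⟨h, hh⟩ := hH
    have hhb : ∀ h ∈ H, ¬ G.Adj h b := fun h hh h' => hbW ((hW b).mpr ⟨hbH, h, hh, h'⟩)
    have h1 := hdeg h a b (hah h hh) (fun h' => hbH (h' ▸ hh)) (hsep.ne hwA hb)
      ((hXH a haX).2.2 h hh) (hhb h hh) (hsep.not_adj a hwA b hb)
    have h2 := degree_add_one_le_card_add (Y := H) hh hW (fun u hu _ => hu) hh
    have h3 : G.degree b ≤ (B \ Z).card + S.card := by
      rw [← card_neighborFinset_eq_degree]
      refine le_trans (card_le_card fun u hu => ?_) (card_union_le _ _)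
      rw [mem_neighborFinset] at hu
      rcases hsep.symm.mem_of_adj hb hu with h | h
      · refine mem_union_left _ (mem_sdiff.mpr ⟨h, ?_⟩)
        rw [hZ, mem_union, not_or]
        exact ⟨fun h' => hhb u h' hu.symm, hbX u h hu⟩
      · exact mem_union_right _ h
    omega
  have hXB : ∀ x ∈ X, x ∉ B := fun x hx hxB =>
    key x hxB (hXH x hx).1 (hXH x hx).2.1 fun u _ hxu hu => hXX x hx u hu hxu
  have hHA : ∀ h ∈ H, h ∉ A := by
    intro h hh hhA
    obtain ⟨b, hb⟩ := hB
    have h1 := hdeg h a b (hah h hh) (hsep.ne hhA hb) (hsep.ne hwA hb)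
      ((hXH a haX).2.2 h hh) (hsep.not_adj h hhA b hb) (hsep.not_adj a hwA b hb)
    have h2 := degree_add_one_le_card_add (Y := H \ B) hh hW
      (fun u hu hhu => mem_sdiff.mpr ⟨hu, fun huB => hsep.not_adj h hhA u huB hhu⟩)
      (mem_sdiff.mpr ⟨hh, Finset.disjoint_left.mp hsep.disjoint hhA⟩)
    have h3 := hsep.degree_add_one_le hb
    have h4 : B \ Z = B \ H := by
      ext u
      have := hXB u
      simp only [hZ, mem_sdiff, mem_union]
      tauto
    have h5 := card_sdiff_add_card_inter B H
    have h6 := card_sdiff_add_card_inter H B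
    rw [inter_comm] at h6
    rw [h4] at hpart
    omega
  have hBHW : ∀ b ∈ B, b ∈ H ∨ b ∈ W := by
    intro b hb
    by_contra hcon
    push Not at hcon
    exact key b hb hcon.1 hcon.2 fun u hu _ hu' => hXB u hu' hu
  by_cases hex : ∃ w' ∈ W, w' ≠ w ∧ nxt f w' ∈ A
  · obtain ⟨w', hw', hne, hwA'⟩ := hex
    have hw'Att := (hW w').mp hw'
    obtain ⟨j, m, hm1, hmN, hj, hjm⟩ := hS.exists_index hwAtt hw'Att hne.symm
    obtain ⟨h1, T, hT1, hT2⟩ := hS.crossing hm1 hmN (hj ▸ hw'Att) (hjm ▸ hwAtt)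
    rw [← hS.nxt_apply, hjm, ← ha] at h1
    rw [← hS.nxt_apply j, hj] at h1 hT2
    rw [← hS.nxt_apply (j - m), hjm, ← ha] at hT2
    simp only [← hS.nxt_apply (j - m), hjm, ← ha] at hT1
    have hTH : ∀ y ∈ T, y ∉ H := by
      intro y hy
      rcases hT1 y hy with ⟨t, -, -, rfl⟩ | ⟨t, -, -, -, rfl⟩ <;> exact hS.notMem _
    have hidx : ∀ u ∈ B ∩ W, ∃ s : ℕ, s < N ∧ f (j - s) = u ∧ s ≠ m := by
      intro u hu
      obtain ⟨i, rfl⟩ := hS.exists_of_attach ((hW u).mp (mem_inter.mp hu).2)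
      obtain ⟨s, hs, hsi⟩ := hS.exists_lt i j
      refine ⟨s, hs, hsi, ?_⟩
      rintro rfl
      have : f i = w := hsi.symm.trans hjm
      rw [this] at hu
      exact hsep.not_adj a hwA w (mem_inter.mp hu).1 (by
        rw [ha]; exact (hS.adj_nxt hwAtt).symm)
    -- The additional set of the crossing lemma has one vertex `f (j - τ u)` for each attached
    -- vertex `u` of `B`: this is `u` itself if `u` lies on the arc from `a` to `w'`, and the
    -- successor of `u` on the other arc.
    have hidx' : ∀ u, ∃ τ : ℕ, u ∈ B ∩ W → τ < N ∧
        ((f (j - τ) = u ∧ τ < m) ∨ (f (j - τ - 1) = u ∧ m ≤ τ ∧ τ + 1 < N)) := by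
      intro u
      by_cases hu : u ∈ B ∩ W
      · obtain ⟨s, hs, hsu, hsm⟩ := hidx u hu
        rcases Nat.lt_or_gt_of_ne hsm with h | h
        · exact ⟨s, fun _ => ⟨hs, Or.inl ⟨hsu, h⟩⟩⟩
        · refine ⟨s - 1, fun _ => ⟨by omega, Or.inr ⟨?_, by omega, by omega⟩⟩⟩
          rw [← hsu]; congr 1; omega
      · exact ⟨0, fun h => absurd h hu⟩
    choose τ hτ using hidx'
    have hτinj : Set.InjOn (fun u => f (j - τ u)) (B ∩ W : Finset V) := by
      intro u hu v hv huv
      have hu' := hτ u hu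
      have hv' := hτ v hv
      have heq : τ u = τ v := by
        by_contra h
        exact hS.ne_of_lt j hu'.1 hv'.1 h huv
      rw [heq] at hu'
      rcases hu'.2 with h | h <;> rcases hv'.2 with h' | h'
      · exact h.1.symm.trans h'.1
      · omega
      · omega
      · exact h.1.symm.trans h'.1
    obtain ⟨b, hb⟩ := hB
    have h2 := hT2 univ (H ∪ (B ∩ W).image fun u => f (j - τ u)) (subset_univ _) (subset_univ _)
      (subset_univ _) (mem_univ _) (subset_univ _) (by
        intro u hu
        rcases mem_union.mp hu with hu | hu
        · exact ⟨fun h => hTH u h hu, fun h => hS.not_adj_nxt hw'Att u hu h.symm,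
            fun h => hS.nxt_notMem hw'Att (h ▸ hu), fun h => absurd h.symm
              ((hXH a haX).2.2 u hu)⟩
        · obtain ⟨v, hv, rfl⟩ := mem_image.mp hu
          obtain ⟨hvN, hv'⟩ := hτ v hv
          obtain ⟨hvB, hvW⟩ := mem_inter.mp hv
          rcases hv' with ⟨h3, h4⟩ | ⟨h3, h4, h5⟩
          · refine ⟨fun hvT => ?_, ?_, ?_, fun _ => ⟨_, rfl⟩⟩
            · rcases hT1 _ hvT with ⟨t, t1, t2, t3⟩ | ⟨t, t1, t2, -, t3⟩
              · have : τ v = t + 1 := by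
                  by_contra h
                  refine hS.ne_of_lt j hvN (show t + 1 < N by omega) h ?_
                  rw [t3]; congr 1; push_cast; ring
                refine hXX a haX (nxt f v) (hX ▸ mem_image_of_mem _ hvW) ?_
                rw [← h3, this, hS.nxt_apply, show j - ((t + 1 : ℕ) : ℤ) + 1 = j - t by
                  push_cast; ring]
                exact t2
              · refine hS.ne_of_lt j hvN (show t - 1 < N by omega) (by omega) ?_
                rw [t3]; congr 1; omega
            · rw [h3]; exact hsep.not_adj _ hwA' v hvB
            · rw [h3]; exact (hsep.ne hwA' hvB).symm
          · have h6 : f (j - τ v) = nxt f v := by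
              have h7 := hS.nxt_apply (j - τ v - 1)
              rw [h3, sub_add_cancel] at h7
              exact h7.symm
            refine ⟨fun hvT => ?_, ?_, ?_, fun _ => ⟨_, rfl⟩⟩
            · rcases hT1 _ hvT with ⟨t, t1, t2, t3⟩ | ⟨t, t1, t2, t4, t3⟩
              · refine hS.ne_of_lt j hvN (show t + 1 < N by omega) (by omega) ?_
                rw [t3]; congr 1; push_cast; ring
              · have : τ v = t - 1 := by
                  by_contra h
                  refine hS.ne_of_lt j hvN (show t - 1 < N by omega) h ?_
                  rw [t3]; congr 1; omega
                refine hsep.not_adj a hwA v hvB ?_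
                rwa [← h3, show j - (τ v : ℤ) - 1 = j - t by omega]
            · rw [h6]; exact hS.not_adj_nxt_nxt hw'Att ((hW v).mp hvW)
            · rw [h6]
              intro h7
              have h8 := hS.ne_of_lt j hvN (show N - 1 < N by omega) (by omega)
              refine h8 (h6.trans (h7.trans ?_))
              rw [← hj, hS.nxt_apply]
              exact hS.eq_of_dvd ⟨1, by omega⟩)
    rw [card_union_of_disjoint, card_image_of_injOn hτinj, card_univ] at h2
    · have h3 := hdeg a (nxt f w') b (fun h => hS.nxt_ne hwAtt hw'Att hne.symm (ha ▸ h))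
        (hsep.ne hwA hb) (hsep.ne hwA' hb) h1 (hsep.not_adj a hwA b hb)
        (hsep.not_adj _ hwA' b hb)
      have h4 := hsep.degree_add_one_le hb
      have h5 : B ⊆ H ∪ (B ∩ W) := fun u hu => by
        have := hBHW u hu
        simp only [mem_union, mem_inter]
        tauto
      have h6 := (card_le_card h5).trans (card_union_le _ _)
      omega
    · rw [Finset.disjoint_right]
      intro u hu
      obtain ⟨v, -, rfl⟩ := mem_image.mp hu
      exact hS.notMem _
  · push Not at hex
    have hXaS : X ⊆ insert a S := by
      intro x hx
      obtain ⟨u, hu, rfl⟩ := mem_image.mp (hX ▸ hx)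
      by_cases huw : u = w
      · rw [huw, ← ha]; exact mem_insert_self _ _
      · rcases hsep.mem (nxt f u) with h | h | h
        · exact absurd h (hex u hu huw)
        · exact absurd h (hXB _ hx)
        · exact mem_insert_of_mem h
    have hXeq : X = insert a S :=
      eq_of_subset_of_card_le hXaS ((card_insert_le _ _).trans (by omega))
    have hSX : ∀ u ∈ S, u ∈ X := fun u hu => hXeq ▸ mem_insert_of_mem hu
    have hHB : ∀ h ∈ H, h ∈ B := by
      intro h hh
      rcases hsep.mem h with h1 | h1 | h1
      · exact absurd h1 (hHA h hh)
      · exact h1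
      · exact absurd hh (hXH h (hSX h h1)).1
    obtain ⟨-, h, hh, hhw⟩ := id hwAtt
    rcases hsep.symm.mem_of_adj (hHB h hh) hhw with h1 | h1
    · exact hsep.not_adj a hwA w h1 (by rw [ha]; exact (hS.adj_nxt hwAtt).symm)
    · exact (hXH w (hSX w h1)).2.1 hw

/-- A cycle that cannot be enlarged through a set `H` attached to it by at least two vertices does
not exist if the degree sum of all independent triples is large compared with the order of some
separator. -/
theorem false_of_isSeparation (hS : G.IsStuck H N f)
    (hdeg : ∀ a b d : V, a ≠ b → a ≠ d → b ≠ d → ¬ G.Adj a b → ¬ G.Adj a d → ¬ G.Adj b d →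
      Fintype.card V + S.card ≤ G.degree a + G.degree b + G.degree d)
    (hsep : G.IsSeparation A B S) (hA : A.Nonempty) (hB : B.Nonempty) {w w' : V}
    (hw : G.Attach H w) (hw' : G.Attach H w') (hne : w ≠ w') : False := by
  classical
  obtain ⟨W, hW⟩ : ∃ W : Finset V, ∀ w, w ∈ W ↔ G.Attach H w :=
    ⟨univ.filter fun w => G.Attach H w, by simp⟩
  obtain ⟨-, h, hh, -⟩ := id hw
  have hWS : S.card < W.card := by
    obtain ⟨j, m, hm1, hmN, rfl, rfl⟩ := hS.exists_index hw hw' hne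
    obtain ⟨h1, T, hT1, hT2⟩ := hS.crossing hm1 hmN hw' hw
    have h2 := hT2 univ H (subset_univ _) (subset_univ _) (subset_univ _) (mem_univ _)
      (subset_univ _) fun u hu => ⟨fun h => by
        rcases hT1 u h with ⟨t, -, -, rfl⟩ | ⟨t, -, -, -, rfl⟩ <;> exact hS.notMem _ hu,
        fun h => hS.not_adj_succ hw' u hu h.symm, fun h => hS.notMem _ (h ▸ hu),
        fun h => absurd h.symm (hS.not_adj_succ hw u hu)⟩
    have h3 := hdeg h (f (j - m + 1)) (f (j + 1)) (fun h' => hS.notMem _ (h' ▸ hh))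
      (fun h' => hS.notMem _ (h' ▸ hh)) (fun h' => by
        refine hne ?_
        have := hS.nxt_ne hw hw' hne
        rw [hS.nxt_apply, hS.nxt_apply] at this
        exact absurd h' this) (hS.not_adj_succ hw h hh) (hS.not_adj_succ hw' h hh) h1
    have h4 := degree_add_one_le_card_add (Y := H) hh hW (fun u hu _ => hu) hh
    rw [card_univ] at h2
    omega
  -- there are too many attached vertices for all successors to lie in `S`
  have hex : ∃ w ∈ W, nxt f w ∉ S := by
    by_contra hcon
    push Not at hcon
    have h1 := card_le_card (image_subset_iff.mpr hcon)
    rw [hS.image_nxt_card fun w hw => (hW w).mp hw] at h1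
    omega
  obtain ⟨u, hu, huS⟩ := hex
  rcases hsep.mem (nxt f u) with h1 | h1 | h1
  · exact hS.false_of_nxt_mem_left hdeg hsep hB ⟨h, hh⟩ hW hWS hu h1
  · exact hS.false_of_nxt_mem_left hdeg hsep.symm hA ⟨h, hh⟩ hW hWS hu h1
  · exact huS h1

end IsStuck

end Cut

/-! ### Longest cycles, balls and connectivity -/

section LongestCycle

variable {V : Type*} [DecidableEq V] {G : SimpleGraph V}

lemma Walk.IsPath.pathOn {a b : V} {p : G.Walk a b} (hp : p.IsPath) :
    G.PathOn p.support.toFinset a b := by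
  induction p with
  | nil => simpa using PathOn.singleton _
  | cons h p ih =>
    rw [Walk.cons_isPath_iff] at hp
    have := (PathOn.singleton (G := G) _).append (ih hp.1) (by simpa using hp.2) h
    rwa [Walk.support_cons, List.toFinset_cons, insert_eq]

omit [DecidableEq V] in
lemma IsPathMap.exists_walk {n : ℕ} : ∀ {p : ℕ → V}, G.IsPathMap n p →
    ∃ w : G.Walk (p 0) (p n), w.IsPath ∧ ∀ u, u ∈ w.support ↔ ∃ i ≤ n, p i = u := by
  induction n with
  | zero =>
    intro p _
    refine ⟨Walk.nil, Walk.IsPath.nil, fun u => ?_⟩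
    simp [eq_comm]
  | succ n ih =>
    intro p hp
    obtain ⟨w, hw, hs⟩ := ih (p := fun i => p (i + 1)) ⟨fun i hi j hj hij => by
      simp only [Set.mem_Iic] at hi hj
      have := hp.inj (show i + 1 ∈ Set.Iic (n + 1) by simp; omega)
        (show j + 1 ∈ Set.Iic (n + 1) by simp; omega) hij
      omega, fun i hi => hp.adj (i + 1) (by omega)⟩
    refine ⟨Walk.cons (hp.adj 0 (by omega)) w, ?_, fun u => ?_⟩
    · rw [Walk.cons_isPath_iff]
      refine ⟨hw, fun h => ?_⟩
      obtain ⟨i, hi, h⟩ := (hs _).mp h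
      exact hp.ne (by omega) (by omega) (by omega) h
    · rw [Walk.support_cons, List.mem_cons, hs]
      constructor
      · rintro (rfl | ⟨i, hi, rfl⟩)
        · exact ⟨0, by omega, rfl⟩
        · exact ⟨i + 1, by omega, rfl⟩
      · rintro ⟨i, hi, rfl⟩
        cases i with
        | zero => exact Or.inl rfl
        | succ i => exact Or.inr ⟨i, by omega, rfl⟩

lemma PathOn.isHamiltonian [Fintype V] {a b : V} (h : G.PathOn univ a b) (hba : G.Adj b a)
    (hcard : 3 ≤ Fintype.card V) : G.IsHamiltonian := by
  intro _
  obtain ⟨n, p, hp, rfl, rfl, hs⟩ := h.exists_isPathMap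
  obtain ⟨w, hw, hws⟩ := hp.exists_walk
  have hham : w.IsHamiltonian := hw.isHamiltonian_of_mem fun u => by
    rw [hws]
    obtain ⟨i, hi, h⟩ := mem_image.mp (hs.symm ▸ mem_univ u)
    exact ⟨i, by simpa [Nat.lt_succ_iff] using hi, h⟩
  refine ⟨p n, Walk.cons hba w,
    Walk.isHamiltonianCycle_iff_isCycle_and_support_count_tail_eq_one.mpr ⟨?_, ?_⟩⟩
  · rw [Walk.isCycle_iff_isPath_tail_and_le_length]
    refine ⟨by simpa using hw, ?_⟩
    rw [Walk.length_cons, hham.length_eq]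
    omega
  · intro u
    simpa using hham u

/-- The vertex `u` is joined to `v` by a walk avoiding `s`. -/
def Avoids (G : SimpleGraph V) (s : Finset V) (v u : V) : Prop :=
  ∃ p : G.Walk v u, ∀ x ∈ p.support, x ∉ s

lemma Avoids.exists_pathOn {s : Finset V} {v u u' : V} (h : G.Avoids s v u)
    (h' : G.Avoids s v u') :
    ∃ t, G.PathOn t u u' ∧ ∀ x ∈ t, G.Avoids s v x := by
  obtain ⟨p, hp⟩ := h
  obtain ⟨q, hq⟩ := h'
  refine ⟨_, (p.reverse.append q).bypass_isPath.pathOn, fun x hx => ?_⟩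
  have h1 := Walk.support_bypass_subset_support _ (List.mem_toFinset.mp hx)
  rw [Walk.mem_support_append_iff, Walk.support_reverse, List.mem_reverse] at h1
  rcases h1 with h1 | h1
  · exact ⟨p.takeUntil x h1, fun y hy => hp y (p.support_takeUntil_subset_support h1 hy)⟩
  · exact ⟨q.takeUntil x h1, fun y hy => hq y (q.support_takeUntil_subset_support h1 hy)⟩

/-- A longest cycle that is not Hamiltonian, together with a component of its complement. -/
theorem Connected.exists_isStuck [Fintype V] (hG : G.Connected)
    (hcard : 3 ≤ Fintype.card V) (hham : ¬ G.IsHamiltonian) :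
    ∃ (H : Finset V) (N : ℕ) (f : ℤ → V), G.IsStuck H N f ∧ ∃ w, G.Attach H w := by
  classical
  -- `P k` holds if there is a cycle of length `k`, or an edge if `k = 2`
  let P : ℕ → Prop := fun k => ∃ s a b, G.PathOn s a b ∧ G.Adj b a ∧ s.card = k
  have hP2 : P 2 := by
    have : Nontrivial V := Fintype.one_lt_card_iff_nontrivial.mp (by omega)
    obtain ⟨a⟩ := hG.nonempty
    obtain ⟨b, hab⟩ := hG.preconnected.exists_adj_of_nontrivial a
    refine ⟨{a} ∪ {b}, a, b, (PathOn.singleton a).append (PathOn.singleton b)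
      (by simpa using hab.ne) hab, hab.symm, ?_⟩
    rw [card_union_of_disjoint (by simpa using hab.ne)]
    simp
  have hPle : ∀ k, P k → k ≤ Fintype.card V := by
    rintro k ⟨s, -, -, -, -, rfl⟩
    exact card_le_univ s
  obtain ⟨N, hN⟩ : ∃ N, N = Nat.findGreatest P (Fintype.card V) := ⟨_, rfl⟩
  have hPN : P N := hN ▸ Nat.findGreatest_spec (hPle 2 hP2) hP2
  have hmax : ∀ k, P k → k ≤ N := fun k hk => hN ▸ Nat.le_findGreatest (hPle k hk) hk
  have hN2 := hmax 2 hP2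
  obtain ⟨s, a, b, hs, hba, hsN⟩ := hPN
  obtain ⟨v, hv⟩ : ∃ v, v ∉ s := by
    by_contra hcon
    push Not at hcon
    rw [eq_univ_iff_forall.mpr hcon] at hs
    exact hham (hs.isHamiltonian hba hcard)
  obtain ⟨n, p, hp, rfl, rfl, hps⟩ := hs.exists_isPathMap
  have hn : n + 1 = N := by
    rw [← hsN, ← hps, card_image_of_injOn, card_range]
    intro i hi j hj hij
    exact hp.inj (by simpa [Nat.lt_succ_iff] using hi) (by simpa [Nat.lt_succ_iff] using hj) hij
  have hNpos : (0 : ℤ) < N := by omega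
  set f : ℤ → V := fun i => p (i % N).toNat with hf
  have hbd : ∀ i : ℤ, 0 ≤ i % N ∧ i % N < N := fun i =>
    ⟨Int.emod_nonneg i hNpos.ne', Int.emod_lt_of_pos i hNpos⟩
  have hfs : ∀ i, f i ∈ s := fun i => by
    rw [← hps]
    refine mem_image_of_mem _ ?_
    have := hbd i
    simp only [mem_range]
    omega
  have hsf : ∀ u ∈ s, ∃ i, f i = u := by
    intro u hu
    obtain ⟨t, ht, rfl⟩ := mem_image.mp (hps ▸ hu)
    refine ⟨t, ?_⟩
    rw [mem_range] at ht
    simp only [hf]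
    rw [Int.emod_eq_of_lt (by omega) (by omega), Int.toNat_natCast]
  set H : Finset V := univ.filter fun u => G.Avoids s v u with hH
  have hmemH : ∀ u, u ∈ H ↔ G.Avoids s v u := by simp [hH]
  have hHs : ∀ u ∈ H, u ∉ s := by
    intro u hu
    obtain ⟨q, hq⟩ := (hmemH u).mp hu
    exact hq u q.end_mem_support
  -- a path outside `H` whose ends are attached to `H` closes up through `H`
  have hclose : ∀ t w w' h h', h ∈ H → h' ∈ H → G.Adj h w → G.Adj h' w' → G.PathOn t w w' →
      Disjoint t H → ∃ r : Finset V, h ∈ r ∧ h' ∈ r ∧ t.card + r.card ≤ N := by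
    intro t w w' h h' hh hh' hhw hhw' ht htH
    obtain ⟨r, hr, hrH⟩ := ((hmemH h').mp hh').exists_pathOn ((hmemH h).mp hh)
    have hdisj : Disjoint t r := htH.mono_right fun x hx => (hmemH x).mpr (hrH x hx)
    refine ⟨r, hr.right_mem, hr.left_mem, hmax _ ⟨_, w, h, ht.append hr hdisj hhw'.symm, hhw, ?_⟩⟩
    exact card_union_of_disjoint hdisj
  have hstuck : G.IsStuck H N f := by
    refine ⟨hN2, ?_, ?_, ?_, fun i hi => hHs _ hi (hfs i), ?_, ?_, ?_⟩
    · intro i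
      have h1 := hbd i
      have h2 := Int.emod_add_mul_ediv i N
      by_cases h : i % N + 1 < N
      · have h3 : (i + 1) % N = i % N + 1 := by
          rw [show i + 1 = (i % N + 1) + N * (i / N) by omega, Int.add_mul_emod_self_left]
          exact Int.emod_eq_of_lt (by omega) h
        simp only [hf, h3]
        rw [Int.toNat_add h1.1 (by norm_num)]
        exact hp.adj _ (by omega)
      · have h3 : (i + 1) % N = 0 := by
          refine Int.emod_eq_zero_of_dvd ⟨i / N + 1, ?_⟩
          rw [mul_add]
          omega
        simp only [hf, h3]
        rw [show (i % N).toNat = n by omega]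
        exact hba
    · intro i j hij
      have h1 := hbd i
      have h2 := hbd j
      have h3 := hp.inj (show (i % N).toNat ∈ Set.Iic n by simp only [Set.mem_Iic]; omega)
        (show (j % N).toNat ∈ Set.Iic n by simp only [Set.mem_Iic]; omega) hij
      exact Int.ModEq.dvd (show j % N = i % N by omega)
    · intro i
      simp [hf]
    · intro h hh u hhu hu
      refine hsf u ?_
      by_contra hus
      obtain ⟨q, hq⟩ := (hmemH h).mp hh
      refine hu ((hmemH u).mpr ⟨q.concat hhu, fun x hx => ?_⟩)
      rw [Walk.support_concat, List.mem_append, List.mem_singleton] at hx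
      rcases hx with hx | rfl
      · exact hq x hx
      · exact hus
    · rintro t w w' - ⟨-, h, hh, hhw⟩ ⟨-, h', hh', hhw'⟩ ht htH
      obtain ⟨r, hr, -, hle⟩ := hclose t w w' h h' hh hh' hhw hhw' ht htH
      have := card_pos.mpr ⟨h, hr⟩
      omega
    · intro t w w' h h' _ _ _ hh hh' hne hhw hhw' ht htH
      obtain ⟨r, hr, hr', hle⟩ := hclose t w w' h h' hh hh' hhw hhw' ht htH
      have := one_lt_card.mpr ⟨h, hr, h', hr', hne⟩
      omega
  refine ⟨H, N, f, hstuck, ?_⟩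
  have hvH : v ∈ H := (hmemH v).mpr ⟨Walk.nil, by simpa using hv⟩
  obtain ⟨q⟩ := hG.preconnected v (f 0)
  obtain ⟨d, -, h1, h2⟩ := q.exists_boundary_dart (H : Set V) hvH (by simpa using hstuck.notMem 0)
  exact ⟨d.snd, by simpa using h2, d.fst, by simpa using h1, d.adj⟩

end LongestCycle

section Balls

variable {V : Type*} {G : SimpleGraph V}

lemma IsKConnected.le_connectivity {W : Type*} [Finite W] {H : SimpleGraph W} {k : ℕ}
    (h : H.IsKConnected k) : k ≤ H.connectivity := by
  classical
  have := Fintype.ofFinite W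
  refine le_csInf ⟨_, univ, rfl, Or.inr (by simp)⟩ ?_
  rintro _ ⟨S, rfl, hS⟩
  by_contra hlt
  push Not at hlt
  rcases hS with hS | hS
  · exact hS (h.2 S hlt).preconnected
  · have h1 := h.1
    rw [Nat.card_eq_fintype_card] at h1
    have h2 : Sᶜ.card ≤ 1 := card_le_one.mpr fun a ha b hb => hS (by simpa using ha)
      (by simpa using hb)
    rw [card_compl] at h2
    omega

/-- In an induced subgraph that remains connected when `w` is removed, every separation of two
vertices other than `w` is crossed by an edge avoiding `w`. -/
lemma IsKConnected.exists_adj {X : Set V} [Finite X] (h : (G.induce X).IsKConnected 2) {w : V}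
    (hw : w ∈ X) {Z : Set V} {a b : V} (ha : a ∈ Z) (hb : b ∉ Z) (haw : a ≠ w) (hbw : b ≠ w)
    (haX : a ∈ X) (hbX : b ∈ X) :
    ∃ u y, u ∈ Z ∧ y ∉ Z ∧ G.Adj u y ∧ u ≠ w ∧ y ≠ w ∧ u ∈ X ∧ y ∈ X := by
  have hc := h.2 {⟨w, hw⟩} (by simp)
  have hmem : ∀ u : X, u.1 ≠ w → u ∈ ((({⟨w, hw⟩} : Finset X) : Set X)ᶜ) := by
    intro u hu
    simp only [coe_singleton, Set.mem_compl_iff, Set.mem_singleton_iff]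
    exact fun h => hu (congrArg Subtype.val h)
  obtain ⟨q⟩ := hc.preconnected ⟨⟨a, haX⟩, hmem _ haw⟩ ⟨⟨b, hbX⟩, hmem _ hbw⟩
  obtain ⟨d, -, h1, h2⟩ := q.exists_boundary_dart {x | x.1.1 ∈ Z} ha hb
  have hne : ∀ x : ((({⟨w, hw⟩} : Finset X) : Set X)ᶜ : Set X), x.1.1 ≠ w := by
    intro x hx
    refine x.2 ?_
    simp only [coe_singleton, Set.mem_singleton_iff]
    exact Subtype.ext hx
  exact ⟨d.fst.1.1, d.snd.1.1, h1, h2, d.adj, hne _, hne _, d.fst.1.2, d.snd.1.2⟩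

lemma Connected.mem_closedBall (hG : G.Connected) {r : ℕ} {v w : V} :
    w ∈ G.closedBall r v ↔ G.dist v w ≤ r := by
  rw [closedBall, Set.mem_ofPred_eq, ← (hG v w).coe_dist_eq_edist, Nat.cast_le]

variable [Fintype V] [DecidableEq V] [DecidableRel G.Adj]

omit [DecidableEq V] [DecidableRel G.Adj] in
lemma Connected.ncard_closedBall_three (hG : G.Connected) (v : V) :
    (G.closedBall 3 v).ncard = (G.ballThree v).card := by
  rw [← Set.ncard_coe_finset]
  congr 1
  ext u
  rw [hG.mem_closedBall, mem_coe, mem_ballThree]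

omit [Fintype V] [DecidableEq V] [DecidableRel G.Adj] in
lemma Connected.isInteriorVertex (hG : G.Connected) {c x : V} (h : G.dist c x ≤ 2) :
    G.IsInteriorVertex 3 c x :=
  ⟨hG.mem_closedBall.mpr (by omega), fun u hu =>
    hG.mem_closedBall.mpr (hG.dist_le_add h (hG.mem_closedBall.mp hu))⟩

omit [Fintype V] [DecidableEq V] [DecidableRel G.Adj] in
lemma isIndepSet_triple {a b d : V} (hab : ¬ G.Adj a b) (had : ¬ G.Adj a d) (hbd : ¬ G.Adj b d) :
    G.IsIndepSet {a, b, d} := by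
  intro x hx y hy _
  simp only [Set.mem_insert_iff, Set.mem_singleton_iff] at hx hy
  rcases hx with rfl | rfl | rfl <;> rcases hy with rfl | rfl | rfl <;>
    simp_all [G.adj_comm]

/-- A disconnecting set of an induced subgraph on all vertices, as a separation of `G`. -/
lemma exists_isSeparation {X : Set V} (hX : ∀ u, u ∈ X) {S : Finset X}
    (h : ¬ ((G.induce X).induce ((S : Set X)ᶜ)).Preconnected) :
    ∃ A B S' : Finset V, G.IsSeparation A B S' ∧ A.Nonempty ∧ B.Nonempty ∧ S'.card = S.card := by
  classical
  rw [Preconnected] at h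
  push Not at h
  obtain ⟨a, b, hab⟩ := h
  set K := (G.induce X).induce ((S : Set X)ᶜ) with hK
  let R : V → Prop := fun x => ∃ hx : (⟨x, hX x⟩ : X) ∈ ((S : Set X)ᶜ), K.Reachable a ⟨_, hx⟩
  let T : V → Prop := fun x => (⟨x, hX x⟩ : X) ∈ S
  have hRT : ∀ x, R x → ¬ T x := fun x hx => hx.1
  refine ⟨univ.filter R, univ.filter fun x => ¬ R x ∧ ¬ T x, univ.filter T, ⟨?_, ?_, ?_, ?_, ?_⟩,
    ⟨a.1.1, ?_⟩, ⟨b.1.1, ?_⟩, ?_⟩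
  · intro u
    simp only [mem_filter, mem_univ, true_and]
    tauto
  · rw [Finset.disjoint_left]
    intro u
    simp only [mem_filter, mem_univ, true_and]
    tauto
  · rw [Finset.disjoint_left]
    intro u
    simp only [mem_filter, mem_univ, true_and]
    exact hRT u
  · rw [Finset.disjoint_left]
    intro u
    simp only [mem_filter, mem_univ, true_and]
    tauto
  · intro u hu y hy huy
    simp only [mem_filter, mem_univ, true_and] at hu hy
    obtain ⟨h1, h2⟩ := hu
    refine hy.1 ⟨hy.2, h2.trans (Adj.reachable ?_)⟩
    exact huy
  · simp only [mem_filter, mem_univ, true_and]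
    exact ⟨a.2, Reachable.refl _⟩
  · simp only [mem_filter, mem_univ, true_and]
    exact ⟨fun h => hab h.2, b.2⟩
  · refine card_bij (fun x _ => ⟨x, hX x⟩) ?_ ?_ ?_
    · intro x hx
      exact (mem_filter.mp hx).2
    · intro x _ y _ h
      exact congrArg Subtype.val h
    · intro y hy
      exact ⟨y.1, mem_filter.mpr ⟨mem_univ _, hy⟩, rfl⟩

end Balls

end SimpleGraph

/-! ### Hamiltonicity -/

theorem mainTheorem1 {V : Type*} [Fintype V] [DecidableEq V] (G : SimpleGraph V)
    [DecidableRel G.Adj] (hcard : 3 ≤ Fintype.card V) (hconn : G.Connected)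
    (hball : ∀ v : V, (G.ballGraph 3 v).IsKConnected 2)
    (hdeg : ∀ v x y z : V, G.IsInteriorVertex 3 v x → G.IsInteriorVertex 3 v y →
      G.IsInteriorVertex 3 v z → x ≠ y → x ≠ z → y ≠ z → G.IsIndepSet {x, y, z} →
      (G.closedBall 3 v).ncard + (G.ballGraph 3 v).connectivity
        ≤ G.degree x + G.degree y + G.degree z) :
    G.IsHamiltonian := by
  by_contra hham
  obtain ⟨H, N, f, hS, w, hw⟩ := hconn.exists_isStuck hcard hham
  by_cases hfull : ∃ v, ∀ u, u ∈ G.closedBall 3 v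
  · obtain ⟨v, hv⟩ := hfull
    have huniv : G.closedBall 3 v = Set.univ := Set.eq_univ_of_forall hv
    have hdeg' : ∀ k ≤ (G.ballGraph 3 v).connectivity, ∀ a b d : V, a ≠ b → a ≠ d → b ≠ d →
        ¬ G.Adj a b → ¬ G.Adj a d → ¬ G.Adj b d →
        Fintype.card V + k ≤ G.degree a + G.degree b + G.degree d := by
      intro k hk a b d h1 h2 h3 h4 h5 h6
      have hint : ∀ x, G.IsInteriorVertex 3 v x := fun x => ⟨hv x, fun u _ => hv u⟩
      have h := hdeg v a b d (hint a) (hint b) (hint d) h1 h2 h3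
        (SimpleGraph.isIndepSet_triple h4 h5 h6)
      have hn : (G.closedBall 3 v).ncard = Fintype.card V := by
        rw [huniv, Set.ncard_univ, Nat.card_eq_fintype_card]
      omega
    obtain ⟨-, h, hh, hhw⟩ := id hw
    -- a second attached vertex, since the graph minus `w` is connected
    obtain ⟨w', hw', hne⟩ : ∃ w', G.Attach H w' ∧ w ≠ w' := by
      obtain ⟨u, y, hu, hy, huy, -, hyw, -, -⟩ := (hball v).exists_adj (hv w) (Z := (H : Set V))
        (a := h) (b := SimpleGraph.nxt f w) hh (hS.nxt_notMem hw) hhw.ne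
        (hS.adj_nxt hw).ne' (hv _) (hv _)
      exact ⟨y, ⟨hy, u, hu, huy⟩, hyw.symm⟩
    -- a set `S` attaining the connectivity
    obtain ⟨S, hSc, hS'⟩ : (G.ballGraph 3 v).connectivity ∈ {k | ∃ S : Finset (G.closedBall 3 v),
        S.card = k ∧ (¬ ((G.ballGraph 3 v).induce ((S : Set _)ᶜ)).Preconnected ∨
          ((S : Set (G.closedBall 3 v))ᶜ).Subsingleton)} := by
      classical
      have := Fintype.ofFinite (G.closedBall 3 v)
      exact Nat.sInf_mem ⟨_, Finset.univ, rfl, Or.inr (by simp)⟩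
    rcases hS' with hS' | hS'
    · obtain ⟨A, B, S', hsep, hA, hB, hc⟩ := SimpleGraph.exists_isSeparation hv hS'
      exact hS.false_of_isSeparation (hdeg' _ (by omega)) hsep hA hB hw hw' hne
    · -- The set `S` misses at most one vertex, so it is at least as large as the set of all
      -- vertices but `h` and `nxt f w`, which separates these two.
      have hna := hS.not_adj_nxt hw h hh
      have hne' := hS.ne_nxt hh hw
      have hsep : G.IsSeparation {h} {SimpleGraph.nxt f w}
          (Finset.univ \ {h, SimpleGraph.nxt f w}) := by
        refine ⟨fun u => ?_, by simpa using hne', ?_, ?_, by simpa using hna⟩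
        · simp only [Finset.mem_singleton, Finset.mem_sdiff, Finset.mem_univ, Finset.mem_insert,
            true_and]
          tauto
        · simp
        · simp
      refine hS.false_of_isSeparation (hdeg' _ ?_) hsep (by simp) (by simp) hw hw' hne
      have h1 : (Finset.univ \ {h, SimpleGraph.nxt f w} : Finset V).card + 2 = Fintype.card V := by
        rw [← Finset.card_pair hne', Finset.card_sdiff_add_card_eq_card (Finset.subset_univ _),
          Finset.card_univ]
      classical
      have := Fintype.ofFinite (G.closedBall 3 v)
      have h2 : Sᶜ.card ≤ 1 := Finset.card_le_one.mpr fun a ha b hb => hS' (by simpa using ha)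
        (by simpa using hb)
      have h3 : Fintype.card (G.closedBall 3 v) = Fintype.card V := by
        rw [← Nat.card_eq_fintype_card, Nat.card_coe_set_eq, huniv, Set.ncard_univ,
          Nat.card_eq_fintype_card]
      rw [Finset.card_compl] at h2
      omega
  · push Not at hfull
    have hT : G.TripleCondition := by
      intro c a b d ha hb hd h1 h2 h3 h4 h5 h6
      have h := hdeg c a b d (hconn.isInteriorVertex ha) (hconn.isInteriorVertex hb)
        (hconn.isInteriorVertex hd) h1 h2 h3 (SimpleGraph.isIndepSet_triple h4 h5 h6)
      have := (hball c).le_connectivity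
      rw [hconn.ncard_closedBall_three] at h
      omega
    have hP : G.PuncturedBallsConnected := by
      intro w a b Z ha hb haw hbw hwa hwb
      obtain ⟨u, y, h1, h2, h3, h4, h5, h6, h7⟩ := (hball w).exists_adj
        (hconn.mem_closedBall.mpr (by simp)) ha hb haw hbw (hconn.mem_closedBall.mpr hwa)
        (hconn.mem_closedBall.mpr hwb)
      exact ⟨u, y, h1, h2, h3, h4, h5, hconn.mem_closedBall.mp h6, hconn.mem_closedBall.mp h7⟩
    have h4 : ∀ u, ∃ y, G.dist u y = 4 := by
      intro u
      obtain ⟨x, hx⟩ := hfull u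
      rw [hconn.mem_closedBall] at hx
      obtain ⟨y, hy, -⟩ := hconn.exists_dist_eq_of_dist_eq_add (i := 4) (j := G.dist u x - 4)
        (show G.dist u x = 4 + (G.dist u x - 4) by omega)
      exact ⟨y, hy⟩
    exact hS.false_of_forall_exists_dist_eq_four hT hconn hP h4 ⟨w, hw⟩
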